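/- Let $n\ge 3$, let $B^n$ be the open unit ball of $\mathbb R^n$ with boundary $S^{n-1}$, and let $W^{1,1}(B^n,S^{n-1})$ be the set of $u\in W^{1,1}(B^n,\mathbb R^n)$ with $\|u\|=1$ almost everywhere. The condition "$u(x)=x$ on $S^{n-1}$" is understood in the Sobolev (trace) sense, i.e. $u-\mathrm{id}\in W^{1,1}_0(B^n,\mathbb R^n)$, and $\|\nabla u\|=\big(\sum_{i,j}(\partial_j u_i)^2\big)^{1/2}$. Let $f:[0,1]\to\mathbb R$ be a non-negative, differentiable, non-decreasing function, and put, with $r=\|x\|$, $$E_{1,f}(u)=\int_{B^n} f(r)\,\|\nabla u\|\,dx .$$ Then the map $u_0(x)=x/\|x\|$ is a minimizer of $E_{1,f}$ among the maps $u\in W^{1,1}(B^n,S^{n-1})$ with $u(x)=x$ on $S^{n-1}$: $u_0$ is itself such a map, and every such $u$ satisfies $E_{1,f}(u_0)\le E_{1,f}(u)$. Moreover, if $f$ has no critical point in $(0,1)$ (that is, $f'(r)\ne 0$ for all $r\in(0,1)$), then $u_0$ is the unique minimizer: for every such $u$, the equality $E_{1,f}(u)=E_{1,f}(u_0)$ holds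 if and only if $u=u_0$ almost everywhere. -/

import Mathlib

open MeasureTheory Filter Topology
open scoped ContDiff ENNReal

noncomputable section

namespace WeightedEnergy

/-- `φ` is a test function on `Ω`: smooth, with compact support contained in `Ω`. -/
def IsTestFunction {E F : Type*} [NormedAddCommGroup E] [NormedSpace ℝ E]
    [NormedAddCommGroup F] [NormedSpace ℝ F] (Ω : Set E) (φ : E → F) : Prop :=
  ContDiff ℝ ∞ φ ∧ HasCompactSupport φ ∧ tsupport φ ⊆ Ω

/-- `u` and `G` are integrable on `Ω` and `G` is the weak (distributional) derivative of `u`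
on `Ω`: `∫_Ω (∂_v φ) u = - ∫_Ω φ (G v)` for all real test functions `φ` and all directions `v`. -/
structure HasWeakFDeriv {E F : Type*} [NormedAddCommGroup E] [NormedSpace ℝ E]
    [MeasureSpace E] [NormedAddCommGroup F] [NormedSpace ℝ F]
    (Ω : Set E) (u : E → F) (G : E → E →L[ℝ] F) : Prop where
  integrable_map : IntegrableOn u Ω
  integrable_deriv : IntegrableOn G Ω
  integral_eq : ∀ φ : E → ℝ, IsTestFunction Ω φ → ∀ v : E,
    ∫ x in Ω, (fderiv ℝ φ x v) • u x = - ∫ x in Ω, φ x • G x v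

/-- The Sobolev space `W^{1,1}(Ω, F)`. -/
def MemW11 {E F : Type*} [NormedAddCommGroup E] [NormedSpace ℝ E]
    [MeasureSpace E] [NormedAddCommGroup F] [NormedSpace ℝ F]
    (Ω : Set E) (u : E → F) : Prop :=
  ∃ G : E → E →L[ℝ] F, HasWeakFDeriv Ω u G

/-- The space `W^{1,1}_0(Ω, F)`: the closure of the test functions in `W^{1,1}(Ω, F)`. -/
def MemW11Zero {E F : Type*} [NormedAddCommGroup E] [NormedSpace ℝ E]
    [MeasureSpace E] [NormedAddCommGroup F] [NormedSpace ℝ F]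
    (Ω : Set E) (w : E → F) : Prop :=
  ∃ G : E → E →L[ℝ] F, HasWeakFDeriv Ω w G ∧
    ∃ φ : ℕ → E → F, (∀ k, IsTestFunction Ω (φ k)) ∧
      Tendsto (fun k => eLpNorm (fun x => w x - φ k x) 1 (volume.restrict Ω)) atTop (𝓝 0) ∧
      Tendsto (fun k => eLpNorm (fun x => G x - fderiv ℝ (φ k) x) 1 (volume.restrict Ω))
        atTop (𝓝 0)

open Classical in
/-- The weak derivative `∇u` of a map `u ∈ W^{1,1}(Ω, F)` (and `0` for all other maps).
It is determined up to a null set, see `HasWeakFDeriv.ae_eq`. -/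
def weakFDeriv {E F : Type*} [NormedAddCommGroup E] [NormedSpace ℝ E]
    [MeasureSpace E] [NormedAddCommGroup F] [NormedSpace ℝ F]
    (Ω : Set E) (u : E → F) : E → E →L[ℝ] F :=
  if h : MemW11 Ω u then h.choose else 0

theorem MemW11.hasWeakFDeriv {E F : Type*} [NormedAddCommGroup E] [NormedSpace ℝ E]
    [MeasureSpace E] [NormedAddCommGroup F] [NormedSpace ℝ F]
    {Ω : Set E} {u : E → F} (h : MemW11 Ω u) : HasWeakFDeriv Ω u (weakFDeriv Ω u) := by
  rw [weakFDeriv, dif_pos h]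
  exact h.choose_spec

/-- On an open set, weak derivatives are unique up to null sets. -/
theorem HasWeakFDeriv.ae_eq {n : ℕ} {Ω : Set (EuclideanSpace ℝ (Fin n))} (hΩ : IsOpen Ω)
    {u : EuclideanSpace ℝ (Fin n) → EuclideanSpace ℝ (Fin n)}
    {G H : EuclideanSpace ℝ (Fin n) →
      EuclideanSpace ℝ (Fin n) →L[ℝ] EuclideanSpace ℝ (Fin n)}
    (hG : HasWeakFDeriv Ω u G) (hH : HasWeakFDeriv Ω u H) :
    G =ᵐ[volume.restrict Ω] H := by
  have key : ∀ i : Fin n, ∀ᵐ x ∂(volume.restrict Ω),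
      G x (EuclideanSpace.single i 1) = H x (EuclideanSpace.single i 1) := by
    intro i
    set v : EuclideanSpace ℝ (Fin n) := EuclideanSpace.single i 1
    have hGv : IntegrableOn (fun x => G x v) Ω := hG.integrable_deriv.apply_continuousLinearMap v
    have hHv : IntegrableOn (fun x => H x v) Ω := hH.integrable_deriv.apply_continuousLinearMap v
    have h0 : ∀ᵐ x ∂volume, x ∈ Ω → G x v - H x v = 0 := by
      refine hΩ.ae_eq_zero_of_integral_contDiff_smul_eq_zero
        (hGv.sub hHv).locallyIntegrableOn ?_
      intro g hg hgc hgs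
      have hb : ∃ C, ∀ x, ‖g x‖ ≤ C := hgc.exists_bound_of_continuous hg.continuous
      obtain ⟨C, hC⟩ := hb
      have i1 : IntegrableOn (fun x => g x • G x v) Ω :=
        Integrable.bdd_smul hGv C hg.continuous.aestronglyMeasurable
          (Eventually.of_forall hC)
      have i2 : IntegrableOn (fun x => g x • H x v) Ω :=
        Integrable.bdd_smul hHv C hg.continuous.aestronglyMeasurable
          (Eventually.of_forall hC)
      have e1 := hG.integral_eq g ⟨hg, hgc, hgs⟩ v
      have e2 := hH.integral_eq g ⟨hg, hgc, hgs⟩ v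
      have e3 : ∫ x in Ω, g x • (G x v - H x v) = 0 := by
        simp only [smul_sub]
        rw [integral_sub i1 i2, sub_eq_zero]
        exact neg_injective (e1.symm.trans e2)
      rw [← e3]
      symm
      apply setIntegral_eq_integral_of_forall_compl_eq_zero
      intro x hx
      rw [image_eq_zero_of_notMem_tsupport (fun h => hx (hgs h)), zero_smul]
    filter_upwards [(ae_restrict_iff' hΩ.measurableSet).2 h0] with x hx
    exact sub_eq_zero.1 hx
  filter_upwards [ae_all_iff.2 key] with x hx
  apply ContinuousLinearMap.coe_injective
  refine (EuclideanSpace.basisFun (Fin n) ℝ).toBasis.ext fun i => ?_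
  simpa using hx i

/-- The Euclidean (Hilbert–Schmidt, Frobenius) norm of a linear map, `(∑_j |A e_j|²)^{1/2}`. -/
def hsNorm {n : ℕ} (A : EuclideanSpace ℝ (Fin n) →L[ℝ] EuclideanSpace ℝ (Fin n)) : ℝ :=
  √(∑ j : Fin n, ‖A (EuclideanSpace.single j 1)‖ ^ 2)

/-- The open unit ball `𝐁ⁿ` of `ℝⁿ`. -/
def unitBall (n : ℕ) : Set (EuclideanSpace ℝ (Fin n)) := Metric.ball 0 1

/-- The maps `u ∈ W^{1,1}(𝐁ⁿ, 𝕊ⁿ⁻¹)`, that is `u ∈ W^{1,1}(𝐁ⁿ, ℝⁿ)` and `|u| = 1` a.e., with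
`u(x) = x` on the boundary `𝕊ⁿ⁻¹` in the Sobolev sense, that is `u - id ∈ W^{1,1}_0(𝐁ⁿ, ℝⁿ)`. -/
structure IsAdmissible {n : ℕ} (u : EuclideanSpace ℝ (Fin n) → EuclideanSpace ℝ (Fin n)) :
    Prop where
  memW11 : MemW11 (unitBall n) u
  norm_eq_one : ∀ᵐ x ∂(volume.restrict (unitBall n)), ‖u x‖ = 1
  boundary : MemW11Zero (unitBall n) (fun x => u x - x)

/-- The weighted energy `E_{1,f}(u) = ∫_{𝐁ⁿ} f(|x|) ‖∇u(x)‖ dx ∈ [0, ∞]`. -/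
def energy {n : ℕ} (f : ℝ → ℝ) (u : EuclideanSpace ℝ (Fin n) → EuclideanSpace ℝ (Fin n)) :
    ℝ≥0∞ :=
  ∫⁻ x in unitBall n, ENNReal.ofReal (f ‖x‖ * hsNorm (weakFDeriv (unitBall n) u x))

/-- The map `u₀(x) = x / |x|`. -/
def radialMap (n : ℕ) : EuclideanSpace ℝ (Fin n) → EuclideanSpace ℝ (Fin n) :=
  fun x => ‖x‖⁻¹ • x

/-- `u` minimizes `E_{1,f}` among the admissible maps. -/
def IsMinimizer {n : ℕ} (f : ℝ → ℝ)
    (u : EuclideanSpace ℝ (Fin n) → EuclideanSpace ℝ (Fin n)) : Prop :=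
  IsAdmissible u ∧
    ∀ w : EuclideanSpace ℝ (Fin n) → EuclideanSpace ℝ (Fin n),
      IsAdmissible w → energy f u ≤ energy f w

end WeightedEnergy

end

/-! The proof is a calibration by the divergence. If `|u| = 1`, each `∂ᵢu` is orthogonal to `u`
(`IsW11Limit.inner_deriv_eq_zero`), so in `div u = ∑ ⟨eᵢ, ∂ᵢu⟩` each `eᵢ` may be replaced by its
projection onto `u^⊥`. Cauchy–Schwarz then gives `div u ≤ √(n-1) ‖∇u‖`
(`euclTrace_le_sqrt_mul_hsNorm`), with equality for `u₀ = x/|x|`. Hence `√(n-1) (E(u) - E(u₀)) ≥ ∫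
f(|x|) div(u - u₀)`.

The right side is nonnegative. Write `f(|x|) = f(0) + ∫_0^{|x|} f'(s) ds` and exchange the
integrals. The `f(0)` term drops because `u - u₀` lies in `W^{1,1}_0`, and what remains is `∫_0^1
f'(s) D(s) ds` with `D(s) = ∫_{|x|>s} div(u - u₀)`, that is `outerDiv u s`. By the divergence
theorem `D(s)` is the flux of `u₀ - u` through the sphere of radius `s`. It is nonnegative because
no unit vector has a larger normal component than the normal itself
(`IsAdmissible.outerDiv_nonneg`).

If `f' > 0` on `(0,1)`, equality of energies forces `D = 0` almost everywhere. The same identity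
with the weight `r²/2` then gives `∫ ⟨x, u₀ - u⟩ = 0` with a nonnegative integrand, so `u = u₀`
(`IsAdmissible.ae_eq_radialMap`).

That `u₀` is admissible is shown by explicit cutoffs of `u₀ - x` near the origin and near the sphere
(`isW11Limit_radialMap_sub`). -/

namespace WeightedEnergy

/-! ### Integration by parts for `C¹` functions -/

section IntegrationByParts

variable {E F : Type*} [NormedAddCommGroup E] [NormedSpace ℝ E] [FiniteDimensional ℝ E]
  [MeasurableSpace E] [BorelSpace E] {μ : Measure E} [μ.IsAddHaarMeasure]
  [NormedAddCommGroup F] [NormedSpace ℝ F]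

theorem integral_smul_fderiv_of_hasCompactSupport {f : E → ℝ} {g : E → F}
    (hf : ContDiff ℝ 1 f) (hg : ContDiff ℝ 1 g)
    (h : HasCompactSupport f ∨ HasCompactSupport g) (v : E) :
    ∫ x, f x • fderiv ℝ g x v ∂μ = -∫ x, fderiv ℝ f x v • g x ∂μ := by
  have hf' : Continuous fun x => fderiv ℝ f x v :=
    (hf.continuous_fderiv one_ne_zero).clm_apply continuous_const
  have hg' : Continuous fun x => fderiv ℝ g x v :=
    (hg.continuous_fderiv one_ne_zero).clm_apply continuous_const
  refine integral_smul_fderiv_eq_neg_fderiv_smul_of_integrable ?_ ?_ ?_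
    (fun x _ => hf.differentiable one_ne_zero x) (fun x _ => hg.differentiable one_ne_zero x)
  · refine (hf'.smul hg.continuous).integrable_of_hasCompactSupport ?_
    rcases h with h | h
    · exact (h.fderiv_apply ℝ v).smul_right
    · exact h.smul_left
  · refine (hf.continuous.smul hg').integrable_of_hasCompactSupport ?_
    rcases h with h | h
    · exact h.smul_right
    · exact (h.fderiv_apply ℝ v).smul_left
  · refine (hf.continuous.smul hg.continuous).integrable_of_hasCompactSupport ?_
    rcases h with h | h
    · exact h.smul_right
    · exact h.smul_left

/-- Both alternatives are used: a weight without boundary condition is paired with the test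
functions approximating a `W^{1,1}_0` map, while weak derivatives and the chain rule test against a
compactly supported `f`. -/
theorem setIntegral_smul_fderiv {Ω : Set E} {f : E → ℝ} {g : E → F}
    (hf : ContDiff ℝ 1 f) (hg : ContDiff ℝ 1 g)
    (h : HasCompactSupport f ∧ tsupport f ⊆ Ω ∨ HasCompactSupport g ∧ tsupport g ⊆ Ω) (v : E) :
    ∫ x in Ω, f x • fderiv ℝ g x v ∂μ = -∫ x in Ω, fderiv ℝ f x v • g x ∂μ := by
  rw [setIntegral_eq_integral_of_forall_compl_eq_zero,
    setIntegral_eq_integral_of_forall_compl_eq_zero,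
    integral_smul_fderiv_of_hasCompactSupport hf hg (h.imp And.left And.left)]
  · intro x hx
    rcases h with h | h
    · rw [fderiv_of_notMem_tsupport ℝ (fun hh => hx (h.2 hh))]; simp
    · rw [image_eq_zero_of_notMem_tsupport (fun hh => hx (h.2 hh))]; simp
  · intro x hx
    rcases h with h | h
    · rw [image_eq_zero_of_notMem_tsupport (fun hh => hx (h.2 hh))]; simp
    · rw [fderiv_of_notMem_tsupport ℝ (fun hh => hx (h.2 hh))]; simp

end IntegrationByParts

/-! ### Limits of test functions in `W^{1,1}` -/

/-- Convergence of integrals when the integrands are controlled by an `L¹`-convergent sequence. -/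
theorem tendsto_integral_of_norm_sub_le {α V W : Type*} [MeasurableSpace α] {μ : Measure α}
    [NormedAddCommGroup V] [NormedSpace ℝ V] [NormedAddCommGroup W]
    {a : ℕ → α → V} {a₀ : α → V} {b : ℕ → α → W} {b₀ : α → W} (C : ℝ)
    (ha : ∀ k, Integrable (a k) μ) (ha₀ : Integrable a₀ μ)
    (h : ∀ k, ∀ᵐ x ∂μ, ‖a k x - a₀ x‖ ≤ C * ‖b₀ x - b k x‖)
    (hb : Tendsto (fun k => eLpNorm (fun x => b₀ x - b k x) 1 μ) atTop (𝓝 0)) :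
    Tendsto (fun k => ∫ x, a k x ∂μ) atTop (𝓝 (∫ x, a₀ x ∂μ)) := by
  refine tendsto_integral_of_L1' a₀ ha₀.1 (Eventually.of_forall ha) ?_
  have hb' : Tendsto (fun k => ENNReal.ofReal C * eLpNorm (fun x => b₀ x - b k x) 1 μ)
      atTop (𝓝 0) := by
    simpa using ENNReal.Tendsto.const_mul hb (Or.inr ENNReal.ofReal_ne_top)
  refine tendsto_of_tendsto_of_tendsto_of_le_of_le tendsto_const_nhds hb'
    (fun _ => zero_le) fun k => ?_
  exact eLpNorm_le_mul_eLpNorm_of_ae_le_mul (h k) 1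

/-- The test functions `φ k` converge to `w`, and their derivatives converge to `G`, in `L¹(Ω)`. -/
structure IsW11Limit {E F : Type*} [NormedAddCommGroup E] [NormedSpace ℝ E]
    [MeasureSpace E] [NormedAddCommGroup F] [NormedSpace ℝ F]
    (Ω : Set E) (w : E → F) (G : E → E →L[ℝ] F) (φ : ℕ → E → F) : Prop where
  integrable_map : IntegrableOn w Ω
  integrable_deriv : IntegrableOn G Ω
  test : ∀ k, IsTestFunction Ω (φ k)
  tendsto_map : Tendsto (fun k => eLpNorm (fun x => w x - φ k x) 1 (volume.restrict Ω))
    atTop (𝓝 0)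
  tendsto_deriv : Tendsto
    (fun k => eLpNorm (fun x => G x - fderiv ℝ (φ k) x) 1 (volume.restrict Ω)) atTop (𝓝 0)

theorem MemW11Zero.exists_isW11Limit {E F : Type*} [NormedAddCommGroup E] [NormedSpace ℝ E]
    [MeasureSpace E] [NormedAddCommGroup F] [NormedSpace ℝ F] {Ω : Set E} {w : E → F}
    (h : MemW11Zero Ω w) : ∃ G φ, IsW11Limit Ω w G φ := by
  obtain ⟨G, hG, φ, h1, h2, h3⟩ := h
  exact ⟨G, φ, hG.integrable_map, hG.integrable_deriv, h1, h2, h3⟩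

section TestFunction

variable {E F : Type*} [NormedAddCommGroup E] [NormedSpace ℝ E] [NormedAddCommGroup F]
  [NormedSpace ℝ F] {Ω : Set E} {φ : E → F}

theorem IsTestFunction.exists_bound (h : IsTestFunction Ω φ) :
    ∃ C, ∀ x, ‖φ x‖ ≤ C ∧ ‖fderiv ℝ φ x‖ ≤ C := by
  obtain ⟨C, hC⟩ := h.2.1.exists_bound_of_continuous h.1.continuous
  obtain ⟨D, hD⟩ := (h.2.1.fderiv ℝ).exists_bound_of_continuous (h.1.continuous_fderiv (by simp))
  exact ⟨max C D, fun x => ⟨(hC x).trans (le_max_left _ _), (hD x).trans (le_max_right _ _)⟩⟩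

theorem IsTestFunction.contDiff_one (h : IsTestFunction Ω φ) : ContDiff ℝ 1 φ :=
  h.1.of_le (by exact_mod_cast le_top)

variable [MeasureSpace E] [BorelSpace E] [IsFiniteMeasureOnCompacts (volume : Measure E)]

theorem IsTestFunction.integrable_map (h : IsTestFunction Ω φ) : IntegrableOn φ Ω :=
  (h.1.continuous.integrable_of_hasCompactSupport h.2.1).integrableOn

theorem IsTestFunction.integrable_fderiv (h : IsTestFunction Ω φ) :
    IntegrableOn (fderiv ℝ φ) Ω :=
  ((h.1.continuous_fderiv (by simp)).integrable_of_hasCompactSupport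
    (h.2.1.fderiv ℝ)).integrableOn

end TestFunction

/-- The chain rule below composes the approximations with a nonlinear map and uses dominated
convergence, which needs pointwise limits and not only `L¹` ones. -/
theorem IsW11Limit.exists_subseq_tendsto_ae {E F : Type*} [NormedAddCommGroup E]
    [NormedSpace ℝ E] [MeasureSpace E] [BorelSpace E]
    [IsFiniteMeasureOnCompacts (volume : Measure E)] [NormedAddCommGroup F] [NormedSpace ℝ F]
    {Ω : Set E} {w : E → F} {G : E → E →L[ℝ] F} {φ : ℕ → E → F} (h : IsW11Limit Ω w G φ) :
    ∃ ψ : ℕ → E → F, IsW11Limit Ω w G ψ ∧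
      ∀ᵐ x ∂(volume.restrict Ω), Tendsto (fun k => ψ k x) atTop (𝓝 (w x)) := by
  have hm : TendstoInMeasure (volume.restrict Ω) φ atTop w := by
    refine tendstoInMeasure_of_tendsto_eLpNorm one_ne_zero
      (fun k => (h.test k).integrable_map.1) h.integrable_map.1 ?_
    refine h.tendsto_map.congr fun k => ?_
    exact eLpNorm_sub_comm _ _ _ _
  obtain ⟨ns, hns, hae⟩ := hm.exists_seq_tendsto_ae
  exact ⟨fun k => φ (ns k), ⟨h.integrable_map, h.integrable_deriv, fun k => h.test _,
    h.tendsto_map.comp hns.tendsto_atTop, h.tendsto_deriv.comp hns.tendsto_atTop⟩, hae⟩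

section Sobolev

variable {E F : Type*} [NormedAddCommGroup E] [NormedSpace ℝ E] [FiniteDimensional ℝ E]
  [MeasureSpace E] [BorelSpace E] [(volume : Measure E).IsAddHaarMeasure]
  [NormedAddCommGroup F] [NormedSpace ℝ F] {Ω : Set E} {w : E → F} {G : E → E →L[ℝ] F}
  {φ : ℕ → E → F}

/-- Functions in `W^{1,1}_0(Ω)` can be integrated by parts against `C¹` functions that need not
vanish on the boundary of `Ω`. -/
theorem IsW11Limit.integral_smul_deriv (h : IsW11Limit Ω w G φ) {H : E → ℝ}
    (hH : ContDiff ℝ 1 H) {C : ℝ} (hC0 : 0 ≤ C)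
    (hC : ∀ᵐ x ∂(volume.restrict Ω), ‖H x‖ ≤ C ∧ ‖fderiv ℝ H x‖ ≤ C) (v : E) :
    ∫ x in Ω, H x • G x v = -∫ x in Ω, fderiv ℝ H x v • w x := by
  have hH' : AEStronglyMeasurable (fun x => fderiv ℝ H x v) (volume.restrict Ω) :=
    ((hH.continuous_fderiv one_ne_zero).clm_apply continuous_const).aestronglyMeasurable
  have hle : ∀ᵐ x ∂(volume.restrict Ω), ‖fderiv ℝ H x v‖ ≤ C * ‖v‖ := hC.mono fun x hx =>
    (ContinuousLinearMap.le_opNorm _ _).trans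
      (mul_le_mul_of_nonneg_right hx.2 (norm_nonneg _))
  have hHm : AEStronglyMeasurable H (volume.restrict Ω) := hH.continuous.aestronglyMeasurable
  have h1 : Tendsto (fun k => ∫ x in Ω, fderiv ℝ H x v • φ k x) atTop
      (𝓝 (∫ x in Ω, fderiv ℝ H x v • w x)) := by
    refine tendsto_integral_of_norm_sub_le (C * ‖v‖)
      (fun k => Integrable.bdd_smul (h.test k).integrable_map _ hH' hle)
      (Integrable.bdd_smul h.integrable_map _ hH' hle)
      (fun k => hle.mono fun x hx => ?_) h.tendsto_map
    rw [← smul_sub, norm_smul, norm_sub_rev]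
    exact mul_le_mul_of_nonneg_right hx (norm_nonneg _)
  have h2 : Tendsto (fun k => ∫ x in Ω, H x • fderiv ℝ (φ k) x v) atTop
      (𝓝 (∫ x in Ω, H x • G x v)) := by
    refine tendsto_integral_of_norm_sub_le (C * ‖v‖)
      (fun k => Integrable.bdd_smul
        ((h.test k).integrable_fderiv.apply_continuousLinearMap v) C
        hHm (hC.mono fun x hx => hx.1))
      (Integrable.bdd_smul (h.integrable_deriv.apply_continuousLinearMap v) C
        hHm (hC.mono fun x hx => hx.1))
      (fun k => hC.mono fun x hx => ?_) h.tendsto_deriv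
    rw [← smul_sub, norm_smul, ← sub_apply, mul_assoc, norm_sub_rev (G x), mul_comm ‖v‖]
    exact mul_le_mul hx.1 (ContinuousLinearMap.le_opNorm _ _) (norm_nonneg _) hC0
  refine tendsto_nhds_unique h2 ?_
  convert! h1.neg using 2 with k
  rw [setIntegral_smul_fderiv hH (h.test k).contDiff_one (Or.inr (h.test k).2)]

/-- The integration by parts identity passes to the limit, so for `x/|x| - x` it suffices to prove
convergence; no integration around the singularity at the origin is needed. -/
theorem IsW11Limit.hasWeakFDeriv (h : IsW11Limit Ω w G φ) : HasWeakFDeriv Ω w G := by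
  refine ⟨h.integrable_map, h.integrable_deriv, fun ψ hψ v => ?_⟩
  obtain ⟨C, hC⟩ := hψ.exists_bound
  rw [h.integral_smul_deriv hψ.contDiff_one ((norm_nonneg _).trans (hC 0).1)
    (Eventually.of_forall hC) v, neg_neg]

theorem IsW11Limit.memW11Zero (h : IsW11Limit Ω w G φ) : MemW11Zero Ω w :=
  ⟨G, h.hasWeakFDeriv, φ, h.test, h.tendsto_map, h.tendsto_deriv⟩

/-- Weak derivatives can be computed by adding a smooth function. -/
theorem HasWeakFDeriv.add_contDiff {g : E → F} (h : HasWeakFDeriv Ω w G) (hg : ContDiff ℝ 1 g)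
    (hgi : IntegrableOn g Ω) (hgi' : IntegrableOn (fderiv ℝ g) Ω) :
    HasWeakFDeriv Ω (fun x => w x + g x) (fun x => G x + fderiv ℝ g x) := by
  have hi : Integrable w (volume.restrict Ω) := h.integrable_map
  have hi' : Integrable G (volume.restrict Ω) := h.integrable_deriv
  have hsum : Integrable (fun x => G x + fderiv ℝ g x) (volume.restrict Ω) := by
    simpa only [sub_neg_eq_add, Pi.neg_apply] using hi'.sub' (Integrable.neg hgi')
  refine ⟨hi.add hgi, hsum, fun ψ hψ v => ?_⟩
  obtain ⟨C, hC⟩ := hψ.exists_bound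
  have hψ' : AEStronglyMeasurable (fun x => fderiv ℝ ψ x v) (volume.restrict Ω) :=
    ((hψ.1.continuous_fderiv (by simp)).clm_apply continuous_const).aestronglyMeasurable
  have hle : ∀ᵐ x ∂(volume.restrict Ω), ‖fderiv ℝ ψ x v‖ ≤ C * ‖v‖ := Eventually.of_forall fun x =>
    (ContinuousLinearMap.le_opNorm _ _).trans
      (mul_le_mul_of_nonneg_right (hC x).2 (norm_nonneg _))
  have hψm : AEStronglyMeasurable ψ (volume.restrict Ω) := hψ.1.continuous.aestronglyMeasurable
  have hψC : ∀ᵐ x ∂(volume.restrict Ω), ‖ψ x‖ ≤ C := Eventually.of_forall fun x => (hC x).1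
  have e1 : ∫ x in Ω, fderiv ℝ ψ x v • (w x + g x)
      = (∫ x in Ω, fderiv ℝ ψ x v • w x) + ∫ x in Ω, fderiv ℝ ψ x v • g x := by
    simp only [smul_add]
    exact integral_add (Integrable.bdd_smul hi _ hψ' hle) (Integrable.bdd_smul hgi _ hψ' hle)
  have e2 : ∫ x in Ω, ψ x • (G x + fderiv ℝ g x) v
      = (∫ x in Ω, ψ x • G x v) + ∫ x in Ω, ψ x • fderiv ℝ g x v := by
    simp only [smul_add, add_apply]
    exact integral_add
      (Integrable.bdd_smul (hi'.apply_continuousLinearMap v) _ hψm hψC)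
      (Integrable.bdd_smul (hgi'.apply_continuousLinearMap v) _ hψm hψC)
  rw [e1, e2, h.integral_eq ψ hψ v, setIntegral_smul_fderiv hψ.contDiff_one hg (Or.inl hψ.2)]
  abel

end Sobolev

end WeightedEnergy

/-! ### Trace against Hilbert–Schmidt norm, and the divergence theorem -/

namespace WeightedEnergy

/-- The trace of an endomorphism of `ℝⁿ`; the trace of `∇u` is the divergence of `u`. -/
noncomputable def euclTrace {n : ℕ}
    (A : EuclideanSpace ℝ (Fin n) →L[ℝ] EuclideanSpace ℝ (Fin n)) : ℝ :=
  ∑ i, A (EuclideanSpace.single i 1) i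

theorem euclTrace_sub {n : ℕ} (A B : EuclideanSpace ℝ (Fin n) →L[ℝ] EuclideanSpace ℝ (Fin n)) :
    euclTrace (A - B) = euclTrace A - euclTrace B := by
  simp [euclTrace]

/-- The vectors `eᵢ - uᵢ u` are the images of the basis under the orthogonal projection onto `u^⊥`,
whose squared Hilbert–Schmidt norm is its rank `n - 1`. -/
theorem sum_norm_single_sub_sq {n : ℕ} (u : EuclideanSpace ℝ (Fin n)) (hu : ‖u‖ = 1) :
    ∑ i : Fin n, ‖EuclideanSpace.single i (1 : ℝ) - u i • u‖ ^ 2 = (n : ℝ) - 1 := by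
  have h (i : Fin n) : ‖EuclideanSpace.single i (1 : ℝ) - u i • u‖ ^ 2 = 1 - u i ^ 2 := by
    rw [@norm_sub_sq_real, norm_smul, hu, inner_smul_right, EuclideanSpace.inner_single_left]
    simp
    ring
  simp only [h, Finset.sum_sub_distrib]
  rw [← EuclideanSpace.real_norm_sq_eq, hu]
  simp

/-- Tangency allows `eᵢ` to be replaced by its projection onto `u^⊥` before Cauchy–Schwarz. This
improves the constant from `√n` to the sharp `√(n-1)`. -/
theorem euclTrace_le_sqrt_mul_hsNorm {n : ℕ}
    {A : EuclideanSpace ℝ (Fin n) →L[ℝ] EuclideanSpace ℝ (Fin n)}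
    {u : EuclideanSpace ℝ (Fin n)} (hu : ‖u‖ = 1)
    (hA : ∀ i, inner ℝ u (A (EuclideanSpace.single i 1)) = 0) :
    euclTrace A ≤ √((n : ℝ) - 1) * hsNorm A := by
  have h1 : euclTrace A = ∑ i, inner ℝ (EuclideanSpace.single i (1 : ℝ) - u i • u)
      (A (EuclideanSpace.single i 1)) := by
    refine Finset.sum_congr rfl fun i _ => ?_
    rw [inner_sub_left, inner_smul_left, hA i, EuclideanSpace.inner_single_left]
    simp
  calc euclTrace A
      ≤ ∑ i, ‖EuclideanSpace.single i (1 : ℝ) - u i • u‖ * ‖A (EuclideanSpace.single i 1)‖ :=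
        h1 ▸ Finset.sum_le_sum fun i _ => real_inner_le_norm _ _
    _ ≤ _ := Real.sum_mul_le_sqrt_mul_sqrt _ _ _
    _ = √((n : ℝ) - 1) * hsNorm A := by rw [sum_norm_single_sub_sq u hu, hsNorm]

theorem continuous_hsNorm {n : ℕ} : Continuous (hsNorm (n := n)) := by
  unfold hsNorm
  fun_prop

theorem continuous_euclTrace {n : ℕ} : Continuous (euclTrace (n := n)) := by
  unfold euclTrace
  fun_prop

theorem hsNorm_nonneg {n : ℕ} (A : EuclideanSpace ℝ (Fin n) →L[ℝ] EuclideanSpace ℝ (Fin n)) :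
    0 ≤ hsNorm A :=
  Real.sqrt_nonneg _

theorem hsNorm_le {n : ℕ} (A : EuclideanSpace ℝ (Fin n) →L[ℝ] EuclideanSpace ℝ (Fin n)) :
    hsNorm A ≤ √n * ‖A‖ := by
  rw [← Real.sqrt_sq (norm_nonneg A), ← Real.sqrt_mul (Nat.cast_nonneg n)]
  refine Real.sqrt_le_sqrt ?_
  calc ∑ j, ‖A (EuclideanSpace.single j 1)‖ ^ 2 ≤ ∑ _j : Fin n, ‖A‖ ^ 2 := by
        refine Finset.sum_le_sum fun j _ => ?_
        gcongr
        simpa using A.le_opNorm (EuclideanSpace.single j 1)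
    _ = n * ‖A‖ ^ 2 := by simp

theorem abs_euclTrace_le {n : ℕ} (A : EuclideanSpace ℝ (Fin n) →L[ℝ] EuclideanSpace ℝ (Fin n)) :
    |euclTrace A| ≤ n * ‖A‖ := by
  calc |euclTrace A| ≤ ∑ i, |A (EuclideanSpace.single i 1) i| := Finset.abs_sum_le_sum_abs _ _
    _ ≤ ∑ _i : Fin n, ‖A‖ := by
        refine Finset.sum_le_sum fun i _ => ?_
        refine (PiLp.norm_apply_le (A (EuclideanSpace.single i 1)) i).trans ?_
        simpa using A.le_opNorm (EuclideanSpace.single i 1)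
    _ = n * ‖A‖ := by simp

section

variable {n : ℕ} {Ω : Set (EuclideanSpace ℝ (Fin n))}
  {G : EuclideanSpace ℝ (Fin n) → EuclideanSpace ℝ (Fin n) →L[ℝ] EuclideanSpace ℝ (Fin n)}

theorem integrableOn_hsNorm (hG : IntegrableOn G Ω) : IntegrableOn (fun x => hsNorm (G x)) Ω := by
  refine Integrable.mono' (hG.norm.const_mul (√n))
    (continuous_hsNorm.comp_aestronglyMeasurable hG.1) (Eventually.of_forall fun x => ?_)
  rw [Real.norm_of_nonneg (hsNorm_nonneg _)]
  exact hsNorm_le _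

theorem integrableOn_euclTrace (hG : IntegrableOn G Ω) :
    IntegrableOn (fun x => euclTrace (G x)) Ω :=
  Integrable.mono' (hG.norm.const_mul (n : ℝ))
    (continuous_euclTrace.comp_aestronglyMeasurable hG.1)
    (Eventually.of_forall fun _ => abs_euclTrace_le _)

/-- The divergence theorem for `W^{1,1}_0` vector fields. -/
theorem IsW11Limit.integral_mul_euclTrace {w : EuclideanSpace ℝ (Fin n) → EuclideanSpace ℝ (Fin n)}
    {φ : ℕ → EuclideanSpace ℝ (Fin n) → EuclideanSpace ℝ (Fin n)} (h : IsW11Limit Ω w G φ)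
    (hΩ : MeasurableSet Ω) (hb : Bornology.IsBounded Ω) {H : EuclideanSpace ℝ (Fin n) → ℝ}
    (hH : ContDiff ℝ 1 H) :
    ∫ x in Ω, H x * euclTrace (G x) = -∫ x in Ω, fderiv ℝ H x (w x) := by
  have hK : IsCompact (closure Ω) := hb.isCompact_closure
  obtain ⟨C, hC⟩ := hK.exists_bound_of_continuousOn hH.continuous.continuousOn
  obtain ⟨D, hD⟩ := hK.exists_bound_of_continuousOn
    (hH.continuous_fderiv one_ne_zero).continuousOn
  have hbd : ∀ᵐ x ∂(volume.restrict Ω),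
      ‖H x‖ ≤ max 0 (max C D) ∧ ‖fderiv ℝ H x‖ ≤ max 0 (max C D) := by
    filter_upwards [ae_restrict_mem hΩ] with x hx
    have hx' := subset_closure hx
    exact ⟨(hC x hx').trans (by simp), (hD x hx').trans (by simp)⟩
  have hHm : AEStronglyMeasurable H (volume.restrict Ω) := hH.continuous.aestronglyMeasurable
  have hH' (v : EuclideanSpace ℝ (Fin n)) :
      AEStronglyMeasurable (fun x => fderiv ℝ H x v) (volume.restrict Ω) :=
    ((hH.continuous_fderiv one_ne_zero).clm_apply continuous_const).aestronglyMeasurable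
  have i1 (v : EuclideanSpace ℝ (Fin n)) : Integrable (fun x => H x • G x v) (volume.restrict Ω) :=
    Integrable.bdd_smul (h.integrable_deriv.apply_continuousLinearMap v) _ hHm
      (hbd.mono fun x hx => hx.1)
  have i2 (v : EuclideanSpace ℝ (Fin n)) :
      Integrable (fun x => fderiv ℝ H x v • w x) (volume.restrict Ω) :=
    Integrable.bdd_smul h.integrable_map (max 0 (max C D) * ‖v‖) (hH' v) (hbd.mono fun x hx =>
      (ContinuousLinearMap.le_opNorm _ _).trans
        (mul_le_mul_of_nonneg_right hx.2 (norm_nonneg _)))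
  have key (i : Fin n) : ∫ x in Ω, H x * G x (EuclideanSpace.single i 1) i
      = -∫ x in Ω, fderiv ℝ H x (EuclideanSpace.single i 1) * w x i := by
    have := congrArg (EuclideanSpace.proj (𝕜 := ℝ) i)
      (h.integral_smul_deriv hH (le_max_left _ _) hbd (EuclideanSpace.single i 1))
    rw [map_neg, ← ContinuousLinearMap.integral_comp_comm _ (i1 _),
      ← ContinuousLinearMap.integral_comp_comm _ (i2 _)] at this
    simpa using this
  have hsum (x : EuclideanSpace ℝ (Fin n)) : fderiv ℝ H x (w x)
      = ∑ i, fderiv ℝ H x (EuclideanSpace.single i 1) * w x i := by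
    conv_lhs => rw [← (EuclideanSpace.basisFun (Fin n) ℝ).sum_repr (w x)]
    simp [mul_comm]
  simp only [euclTrace, Finset.mul_sum, hsum]
  rw [integral_finsetSum _ fun i _ => by
      simpa using! (EuclideanSpace.proj (𝕜 := ℝ) i).integrable_comp (i1 (EuclideanSpace.single i 1)),
    integral_finsetSum _ fun i _ => by
      simpa using! (EuclideanSpace.proj (𝕜 := ℝ) i).integrable_comp (i2 (EuclideanSpace.single i 1)),
    ← Finset.sum_neg_distrib]
  exact Finset.sum_congr rfl fun i _ => key i

end

end WeightedEnergy

/-! ### Chain rule and tangency of the weak derivative -/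

namespace WeightedEnergy

section ChainRule

variable {F : Type*} [NormedAddCommGroup F] [InnerProductSpace ℝ F]

/-- `√(1 + |y|²)` replaces `|y|²` in differentiating the constraint `|u| = 1`: it is also smooth and
constant on the sphere, but its gradient is bounded, so `L¹` convergence of maps and derivatives
suffices. -/
theorem contDiff_sqrt_one_add_norm_sq : ContDiff ℝ ∞ fun y : F => √(1 + ‖y‖ ^ 2) :=
  (contDiff_const.add (contDiff_norm_sq ℝ)).sqrt fun y => by positivity

theorem hasFDerivAt_sqrt_one_add_norm_sq (y : F) :
    HasFDerivAt (fun y : F => √(1 + ‖y‖ ^ 2)) ((√(1 + ‖y‖ ^ 2))⁻¹ • innerSL ℝ y) y := by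
  have h := (((hasStrictFDerivAt_norm_sq y).hasFDerivAt).const_add 1).sqrt
    (by positivity : (1 : ℝ) + ‖y‖ ^ 2 ≠ 0)
  convert! h using 1
  ext v
  simp
  ring

theorem norm_inv_sqrt_one_add_norm_sq_smul_le (y : F) : ‖(√(1 + ‖y‖ ^ 2))⁻¹ • y‖ ≤ 1 := by
  rw [norm_smul, norm_inv, Real.norm_of_nonneg (Real.sqrt_nonneg _), inv_mul_le_iff₀ (by positivity),
    mul_one]
  exact Real.le_sqrt_of_sq_le (by linarith)

theorem abs_sqrt_one_add_norm_sq_sub_le (y z : F) :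
    |√(1 + ‖y‖ ^ 2) - √(1 + ‖z‖ ^ 2)| ≤ ‖y - z‖ := by
  rw [← Real.norm_eq_abs]
  have h := Convex.norm_image_sub_le_of_norm_hasFDerivWithin_le (𝕜 := ℝ) (C := 1)
    (fun x (_ : x ∈ (Set.univ : Set F)) => (hasFDerivAt_sqrt_one_add_norm_sq x).hasFDerivWithinAt)
    (fun x _ => ?_) convex_univ (Set.mem_univ z) (Set.mem_univ y)
  · simpa using h
  · rw [← map_smul, innerSL_apply_norm]
    exact norm_inv_sqrt_one_add_norm_sq_smul_le x

end ChainRule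

variable {n : ℕ} {Ω : Set (EuclideanSpace ℝ (Fin n))}

theorem integrableOn_of_isBounded (hb : Bornology.IsBounded Ω) {F : Type*} [NormedAddCommGroup F]
    {g : EuclideanSpace ℝ (Fin n) → F} (hg : Continuous g) : IntegrableOn g Ω :=
  (hg.continuousOn.integrableOn_compact hb.isCompact_closure).mono_set subset_closure

/-- The weak derivative of a map into the unit sphere is tangential. The map is `w + id`, with
`w ∈ W^{1,1}_0`. -/
theorem IsW11Limit.inner_deriv_eq_zero
    {w : EuclideanSpace ℝ (Fin n) → EuclideanSpace ℝ (Fin n)}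
    {G : EuclideanSpace ℝ (Fin n) → EuclideanSpace ℝ (Fin n) →L[ℝ] EuclideanSpace ℝ (Fin n)}
    {φ : ℕ → EuclideanSpace ℝ (Fin n) → EuclideanSpace ℝ (Fin n)}
    (hφ : IsW11Limit Ω w G φ) (hΩ : IsOpen Ω) (hb : Bornology.IsBounded Ω)
    (hw : ∀ᵐ x ∂(volume.restrict Ω), ‖w x + x‖ = 1) (v : EuclideanSpace ℝ (Fin n)) :
    ∀ᵐ x ∂(volume.restrict Ω), inner ℝ (w x + x) (G x v + v) = 0 := by
  obtain ⟨φ, h, hae⟩ := hφ.exists_subseq_tendsto_ae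
  -- `q` is the gradient of `√(1 + |y|²)`; it is bounded by `1` and is a positive multiple of `y`.
  let q : EuclideanSpace ℝ (Fin n) → EuclideanSpace ℝ (Fin n) :=
    fun y => (√(1 + ‖y‖ ^ 2))⁻¹ • y
  have hqc : Continuous q := by
    refine (contDiff_sqrt_one_add_norm_sq.continuous.inv₀ fun y => ?_).smul continuous_id
    positivity
  have hq1 (y) : ‖q y‖ ≤ 1 := norm_inv_sqrt_one_add_norm_sq_smul_le y
  have hum : AEStronglyMeasurable (fun x => w x + x) (volume.restrict Ω) :=
    h.integrable_map.1.add continuous_id.aestronglyMeasurable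
  have hvc (k : ℕ) : ContDiff ℝ 1 fun x => φ k x + x := (h.test k).contDiff_one.add contDiff_id
  have hGv : Integrable (fun x => G x v) (volume.restrict Ω) :=
    h.integrable_deriv.apply_continuousLinearMap v
  have hGvv : Integrable (fun x => G x v + v) (volume.restrict Ω) :=
    hGv.add (integrableOn_of_isBounded hb continuous_const)
  have hgv (k : ℕ) : Integrable (fun x => fderiv ℝ (φ k) x v) (volume.restrict Ω) :=
    (h.test k).integrable_fderiv.apply_continuousLinearMap v
  -- products of bounded vector fields with integrable ones
  have hint (a : EuclideanSpace ℝ (Fin n) → EuclideanSpace ℝ (Fin n))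
      (ha : AEStronglyMeasurable a (volume.restrict Ω)) (ψ : EuclideanSpace ℝ (Fin n) → ℝ)
      (hψ : IsTestFunction Ω ψ) (b : EuclideanSpace ℝ (Fin n) → EuclideanSpace ℝ (Fin n))
      (hb : Integrable b (volume.restrict Ω)) :
      Integrable (fun x => ψ x * inner ℝ (q (a x)) (b x)) (volume.restrict Ω) := by
    obtain ⟨C, hC⟩ := hψ.exists_bound
    refine Integrable.mono' (hb.norm.const_mul C) (hψ.1.continuous.aestronglyMeasurable.mul
      ((hqc.comp_aestronglyMeasurable ha).inner hb.1)) (Eventually.of_forall fun x => ?_)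
    rw [norm_mul]
    refine mul_le_mul (hC x).1 ?_ (norm_nonneg _) ((norm_nonneg _).trans (hC x).1)
    refine (norm_inner_le_norm _ _).trans ?_
    simpa using mul_le_mul_of_nonneg_right (hq1 (a x)) (norm_nonneg (b x))
  have key (ψ : EuclideanSpace ℝ (Fin n) → ℝ) (hψ : IsTestFunction Ω ψ) :
      ∫ x in Ω, ψ x * inner ℝ (q (w x + x)) (G x v + v) = 0 := by
    obtain ⟨C, hC⟩ := hψ.exists_bound
    have hC0 : 0 ≤ C := (norm_nonneg _).trans (hC 0).1
    have hψ' : Continuous fun x => fderiv ℝ ψ x v :=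
      (hψ.1.continuous_fderiv (by simp)).clm_apply continuous_const
    have hle (x) : ‖fderiv ℝ ψ x v‖ ≤ C * ‖v‖ :=
      (ContinuousLinearMap.le_opNorm _ _).trans
        (mul_le_mul_of_nonneg_right (hC x).2 (norm_nonneg _))
    -- The derivative `∂ᵥφₖ + v` is split as `(∂ᵥφₖ - Gv) + (Gv + v)`: the first part tends to `0`
    -- in `L¹` against the bounded `q`, and the second is a fixed integrable field, so dominated
    -- convergence applies.
    have hsplit (k : ℕ) : (∫ x in Ω, ψ x * inner ℝ (q (φ k x + x)) (fderiv ℝ (φ k) x v - G x v))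
        + ∫ x in Ω, ψ x * inner ℝ (q (φ k x + x)) (G x v + v)
        = -∫ x in Ω, fderiv ℝ ψ x v * √(1 + ‖φ k x + x‖ ^ 2) := by
      have e := setIntegral_smul_fderiv (μ := volume) (Ω := Ω) hψ.contDiff_one
        ((contDiff_sqrt_one_add_norm_sq.of_le (by exact_mod_cast le_top)).comp (hvc k))
        (Or.inl hψ.2) v
      simp only [smul_eq_mul, Function.comp_apply] at e
      rw [← e, ← integral_add (hint _ (hvc k).continuous.aestronglyMeasurable ψ hψ _
        ((hgv k).sub' hGv)) (hint _ (hvc k).continuous.aestronglyMeasurable ψ hψ _ hGvv)]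
      refine integral_congr_ae (Eventually.of_forall fun x => ?_)
      have hd : HasFDerivAt (fun x => φ k x + x) (fderiv ℝ (φ k) x + ContinuousLinearMap.id ℝ _) x :=
        (((h.test k).contDiff_one.differentiable one_ne_zero x).hasFDerivAt).add (hasFDerivAt_id x)
      have hd' := HasFDerivAt.comp (f := fun x => φ k x + x) x
        (hasFDerivAt_sqrt_one_add_norm_sq (φ k x + x)) hd
      simp only [hd'.fderiv, ← mul_add, ← inner_add_right]
      simp only [q, inner_smul_left, ContinuousLinearMap.comp_apply, smul_apply,
        innerSL_apply_apply, add_apply, ContinuousLinearMap.id_apply, smul_eq_mul, conj_trivial]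
      rw [show fderiv ℝ (φ k) x v - G x v + (G x v + v) = fderiv ℝ (φ k) x v + v by abel]
    have t1 : Tendsto
        (fun k => ∫ x in Ω, ψ x * inner ℝ (q (φ k x + x)) (fderiv ℝ (φ k) x v - G x v))
        atTop (𝓝 0) := by
      have := tendsto_integral_of_norm_sub_le (μ := volume.restrict Ω) (C * ‖v‖)
        (fun k => hint _ (hvc k).continuous.aestronglyMeasurable ψ hψ _ ((hgv k).sub' hGv))
        (a₀ := fun _ => (0 : ℝ)) (integrable_zero _ _ _)
        (fun k => Eventually.of_forall fun x => ?_) h.tendsto_deriv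
      · simpa using this
      · rw [sub_zero, norm_mul, ← sub_apply, norm_sub_rev (G x), mul_assoc]
        refine mul_le_mul (hC x).1 ?_ (norm_nonneg _) hC0
        refine (norm_inner_le_norm _ _).trans ?_
        rw [mul_comm ‖v‖, ← one_mul (_ * ‖v‖)]
        exact mul_le_mul (hq1 _) (ContinuousLinearMap.le_opNorm _ _) (norm_nonneg _) zero_le_one
    have t2 : Tendsto (fun k => ∫ x in Ω, ψ x * inner ℝ (q (φ k x + x)) (G x v + v)) atTop
        (𝓝 (∫ x in Ω, ψ x * inner ℝ (q (w x + x)) (G x v + v))) := by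
      refine tendsto_integral_of_dominated_convergence (fun x => C * ‖G x v + v‖)
        (fun k => (hint _ (hvc k).continuous.aestronglyMeasurable ψ hψ _ hGvv).1)
        (hGvv.norm.const_mul C) (fun k => Eventually.of_forall fun x => ?_) ?_
      · rw [norm_mul]
        refine mul_le_mul (hC x).1 ?_ (norm_nonneg _) hC0
        refine (norm_inner_le_norm _ _).trans ?_
        simpa using mul_le_mul_of_nonneg_right (hq1 (φ k x + x)) (norm_nonneg (G x v + v))
      · filter_upwards [hae] with x hx
        exact (((hqc.tendsto _).comp (hx.add_const x)).inner tendsto_const_nhds).const_mul _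
    have t3 : Tendsto (fun k => ∫ x in Ω, fderiv ℝ ψ x v * √(1 + ‖φ k x + x‖ ^ 2)) atTop
        (𝓝 (∫ x in Ω, fderiv ℝ ψ x v * √(1 + ‖w x + x‖ ^ 2))) := by
      refine tendsto_integral_of_norm_sub_le (C * ‖v‖) (fun k => ?_) ?_
        (fun k => Eventually.of_forall fun x => ?_) h.tendsto_map
      · refine integrableOn_of_isBounded hb (hψ'.mul ?_)
        exact contDiff_sqrt_one_add_norm_sq.continuous.comp (hvc k).continuous
      · refine ((integrableOn_of_isBounded hb hψ').mul_const (√2)).congr ?_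
        filter_upwards [hw] with x hx
        rw [hx]
        norm_num
      · rw [← mul_sub, norm_mul, norm_sub_rev (w x)]
        refine mul_le_mul (hle x) ?_ (norm_nonneg _) (by positivity)
        simpa using abs_sqrt_one_add_norm_sq_sub_le (φ k x + x) (w x + x)
    -- On the constraint the square root is the constant `√2`, and the derivative of a test function
    -- has integral zero.
    have e3 : ∫ x in Ω, fderiv ℝ ψ x v * √(1 + ‖w x + x‖ ^ 2) = 0 := by
      have e := setIntegral_smul_fderiv (μ := volume) (Ω := Ω) (g := fun _ => √2)
        hψ.contDiff_one contDiff_const (Or.inl hψ.2) v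
      have : ∫ x in Ω, fderiv ℝ ψ x v * √(1 + ‖w x + x‖ ^ 2)
          = ∫ x in Ω, fderiv ℝ ψ x v * √2 := by
        refine integral_congr_ae ?_
        filter_upwards [hw] with x hx
        rw [hx]
        norm_num
      rw [this]
      simpa using e.symm
    have := tendsto_nhds_unique ((t1.add t2).congr hsplit) t3.neg
    rw [e3] at this
    simpa using this
  have h0 : ∀ᵐ x ∂volume, x ∈ Ω → inner ℝ (q (w x + x)) (G x v + v) = 0 := by
    refine hΩ.ae_eq_zero_of_integral_contDiff_smul_eq_zero ?_ fun ψ hψ hψc hψs => ?_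
    · refine IntegrableOn.locallyIntegrableOn ?_
      refine Integrable.mono' hGvv.norm
        ((hqc.comp_aestronglyMeasurable hum).inner hGvv.1) (Eventually.of_forall fun x => ?_)
      refine (norm_inner_le_norm _ _).trans ?_
      simpa using mul_le_mul_of_nonneg_right (hq1 (w x + x)) (norm_nonneg (G x v + v))
    · rw [← key ψ ⟨hψ, hψc, hψs⟩]
      symm
      apply setIntegral_eq_integral_of_forall_compl_eq_zero
      intro x hx
      rw [image_eq_zero_of_notMem_tsupport (fun h => hx (hψs h)), zero_mul]
  filter_upwards [(ae_restrict_iff' hΩ.measurableSet).2 h0] with x hx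
  simp only [q, inner_smul_left, map_inv₀] at hx
  refine (mul_eq_zero.1 hx).resolve_left (inv_ne_zero ?_)
  simp only [RCLike.conj_to_real]
  positivity

end WeightedEnergy

/-! ### Cutoffs and the derivative of `x/|x|` -/

namespace WeightedEnergy

theorem tendsto_eLpNorm_one_zero_of_dominated {α V : Type*} [MeasurableSpace α] {μ : Measure α}
    [NormedAddCommGroup V] {a : ℕ → α → V} {g : α → ℝ}
    (ha : ∀ k, AEStronglyMeasurable (a k) μ) (hg : Integrable g μ)
    (hle : ∀ k, ∀ᵐ x ∂μ, ‖a k x‖ ≤ g x)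
    (hlim : ∀ᵐ x ∂μ, Tendsto (fun k => a k x) atTop (𝓝 0)) :
    Tendsto (fun k => eLpNorm (a k) 1 μ) atTop (𝓝 0) := by
  simp only [eLpNorm_one_eq_lintegral_enorm]
  have h := tendsto_lintegral_of_dominated_convergence' (μ := μ) (F := fun k x => ‖a k x‖ₑ)
    (f := fun _ => 0) (fun x => ‖g x‖ₑ) (fun k => (ha k).enorm) (fun k => ?_) hg.2.ne ?_
  · simpa using h
  · filter_upwards [hle k] with x hx
    rw [enorm_le_iff_norm_le]
    exact hx.trans (Real.le_norm_self _)
  · filter_upwards [hlim] with x hx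
    simpa using hx.enorm

/-! ### A smooth cutoff on the line -/

/-- A smooth function that vanishes on `(-∞, 1]` and equals `1` on `[2, ∞)`. -/
noncomputable def cutoff (t : ℝ) : ℝ := Real.smoothTransition (t - 1)

theorem contDiff_cutoff : ContDiff ℝ ∞ cutoff :=
  Real.smoothTransition.contDiff.comp (contDiff_id.sub contDiff_const)

theorem cutoff_of_le_one {t : ℝ} (h : t ≤ 1) : cutoff t = 0 :=
  Real.smoothTransition.zero_of_nonpos (by linarith)

theorem cutoff_of_two_le {t : ℝ} (h : 2 ≤ t) : cutoff t = 1 :=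
  Real.smoothTransition.one_of_one_le (by linarith)

theorem abs_cutoff_le_one (t : ℝ) : |cutoff t| ≤ 1 := by
  rw [cutoff, abs_of_nonneg (Real.smoothTransition.nonneg _)]
  exact Real.smoothTransition.le_one _

theorem cutoff_nonneg (t : ℝ) : 0 ≤ cutoff t := Real.smoothTransition.nonneg _

theorem deriv_cutoff_of_lt_one {t : ℝ} (h : t < 1) : deriv cutoff t = 0 := by
  have : cutoff =ᶠ[𝓝 t] fun _ => 0 := by
    filter_upwards [Iio_mem_nhds h] with s hs using cutoff_of_le_one hs.le
  rw [this.deriv_eq, deriv_const]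

theorem deriv_cutoff_of_two_lt {t : ℝ} (h : 2 < t) : deriv cutoff t = 0 := by
  have : cutoff =ᶠ[𝓝 t] fun _ => 1 := by
    filter_upwards [Ioi_mem_nhds h] with s hs using cutoff_of_two_le hs.le
  rw [this.deriv_eq, deriv_const]

/-- The bound is scale invariant: taking `t = κ r` gives `|κ cutoff'(κ r)| ≤ C / r` for `r > 0` with
`C` independent of `κ`. -/
theorem exists_abs_mul_deriv_cutoff_le : ∃ C, ∀ t : ℝ, |t * deriv cutoff t| ≤ C := by
  obtain ⟨C, hC⟩ := (isCompact_Icc (a := (1 : ℝ)) (b := 2)).exists_bound_of_continuousOn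
    (continuous_id.mul (contDiff_cutoff.continuous_deriv (by simp))).continuousOn
  refine ⟨max 0 C, fun t => ?_⟩
  by_cases h1 : t < 1
  · simp [deriv_cutoff_of_lt_one h1]
  by_cases h2 : 2 < t
  · simp [deriv_cutoff_of_two_lt h2]
  exact (hC t ⟨not_lt.1 h1, not_lt.1 h2⟩).trans (le_max_right _ _)

/-! ### The map `x / |x|` -/

variable {n : ℕ}

/-- The derivative of `x / |x|` away from the origin. -/
noncomputable def radialDeriv (x : EuclideanSpace ℝ (Fin n)) :
    EuclideanSpace ℝ (Fin n) →L[ℝ] EuclideanSpace ℝ (Fin n) :=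
  ‖x‖⁻¹ • (ContinuousLinearMap.id ℝ _ -
    (innerSL ℝ (radialMap n x)).smulRight (radialMap n x))

theorem norm_radialMap {x : EuclideanSpace ℝ (Fin n)} (hx : x ≠ 0) : ‖radialMap n x‖ = 1 := by
  rw [radialMap, norm_smul, norm_inv, norm_norm, inv_mul_cancel₀ (norm_ne_zero_iff.2 hx)]

theorem norm_radialMap_le (x : EuclideanSpace ℝ (Fin n)) : ‖radialMap n x‖ ≤ 1 := by
  by_cases hx : x = 0
  · simp [hx, radialMap]
  · exact (norm_radialMap hx).le

theorem norm_smul_radialMap (x : EuclideanSpace ℝ (Fin n)) : ‖x‖ • radialMap n x = x := by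
  by_cases hx : x = 0
  · simp [hx, radialMap]
  · rw [radialMap, smul_smul, mul_inv_cancel₀ (norm_ne_zero_iff.2 hx), one_smul]

theorem hasFDerivAt_norm_of_ne_zero {x : EuclideanSpace ℝ (Fin n)} (hx : x ≠ 0) :
    HasFDerivAt (fun y : EuclideanSpace ℝ (Fin n) => ‖y‖) (innerSL ℝ (radialMap n x)) x := by
  have h := (hasStrictFDerivAt_norm_sq x).hasFDerivAt.sqrt (by simpa using hx)
  simp only [Real.sqrt_sq (norm_nonneg _)] at h
  convert! h using 1
  ext v
  simp [radialMap]
  ring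

theorem hasFDerivAt_radialMap {x : EuclideanSpace ℝ (Fin n)} (hx : x ≠ 0) :
    HasFDerivAt (radialMap n) (radialDeriv x) x := by
  have hx' : ‖x‖ ≠ 0 := norm_ne_zero_iff.2 hx
  have h := ((hasDerivAt_inv hx').comp_hasFDerivAt x (hasFDerivAt_norm_of_ne_zero hx)).smul
    (hasFDerivAt_id x)
  convert! h using 1
  ext1 v
  simp only [radialDeriv, radialMap, smul_apply, sub_apply, add_apply, ContinuousLinearMap.id_apply,
    ContinuousLinearMap.smulRight_apply, innerSL_apply_apply, id_eq, map_smul, smul_sub, smul_smul]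
  rw [sub_eq_add_neg, ← neg_smul]
  congr 2
  simp
  field_simp

theorem contDiffAt_radialMap {x : EuclideanSpace ℝ (Fin n)} (hx : x ≠ 0) :
    ContDiffAt ℝ ∞ (radialMap n) x :=
  ((contDiffAt_norm ℝ hx).inv (norm_ne_zero_iff.2 hx)).smul contDiffAt_id

theorem stronglyMeasurable_radialMap : StronglyMeasurable (radialMap n) :=
  (measurable_norm.inv.stronglyMeasurable).smul continuous_id.stronglyMeasurable

theorem stronglyMeasurable_radialDeriv : StronglyMeasurable (radialDeriv (n := n)) := by
  refine StronglyMeasurable.smul measurable_norm.inv.stronglyMeasurable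
    (stronglyMeasurable_const.sub ?_)
  have : Continuous fun p : EuclideanSpace ℝ (Fin n) => (innerSL ℝ p).smulRight p := by fun_prop
  exact this.comp_stronglyMeasurable stronglyMeasurable_radialMap

theorem norm_radialDeriv_le (x : EuclideanSpace ℝ (Fin n)) : ‖radialDeriv x‖ ≤ 2 * ‖x‖⁻¹ := by
  rw [radialDeriv, norm_smul, norm_inv, norm_norm, mul_comm]
  refine mul_le_mul_of_nonneg_right ((norm_sub_le _ _).trans ?_) (by positivity)
  have h1 : ‖ContinuousLinearMap.id ℝ (EuclideanSpace ℝ (Fin n))‖ ≤ 1 :=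
    ContinuousLinearMap.norm_id_le
  have h2 : ‖(innerSL ℝ (radialMap n x)).smulRight (radialMap n x)‖ ≤ 1 := by
    rw [ContinuousLinearMap.norm_smulRight_apply, innerSL_apply_norm]
    exact mul_le_one₀ (norm_radialMap_le x) (norm_nonneg _) (norm_radialMap_le x)
  linarith

theorem radialDeriv_single (x : EuclideanSpace ℝ (Fin n)) (i : Fin n) :
    radialDeriv x (EuclideanSpace.single i 1)
      = ‖x‖⁻¹ • (EuclideanSpace.single i (1 : ℝ) - radialMap n x i • radialMap n x) := by
  simp [radialDeriv, EuclideanSpace.inner_single_right]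

theorem hsNorm_radialDeriv {x : EuclideanSpace ℝ (Fin n)} (hx : x ≠ 0) :
    hsNorm (radialDeriv x) = ‖x‖⁻¹ * √((n : ℝ) - 1) := by
  simp only [hsNorm, radialDeriv_single, norm_smul, mul_pow]
  rw [← Finset.mul_sum, sum_norm_single_sub_sq _ (norm_radialMap hx),
    Real.sqrt_mul (by positivity), Real.sqrt_sq (norm_nonneg _), norm_inv, norm_norm]

theorem euclTrace_radialDeriv {x : EuclideanSpace ℝ (Fin n)} (hx : x ≠ 0) :
    euclTrace (radialDeriv x) = ‖x‖⁻¹ * ((n : ℝ) - 1) := by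
  have h := EuclideanSpace.real_norm_sq_eq (radialMap n x)
  rw [norm_radialMap hx] at h
  simp only [euclTrace, radialDeriv_single, PiLp.smul_apply, PiLp.sub_apply, smul_eq_mul]
  rw [← Finset.mul_sum, Finset.sum_sub_distrib]
  simp [← pow_two, ← h]

/-- The equality case of the calibration: the derivative of `x/|x|` is a multiple of the projection
onto `x^⊥`. -/
theorem euclTrace_radialDeriv_eq (hn : 1 ≤ n) {x : EuclideanSpace ℝ (Fin n)} (hx : x ≠ 0) :
    euclTrace (radialDeriv x) = √((n : ℝ) - 1) * hsNorm (radialDeriv x) := by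
  have h : (0 : ℝ) ≤ n - 1 := by simpa using hn
  rw [euclTrace_radialDeriv hx, hsNorm_radialDeriv hx, mul_left_comm, Real.mul_self_sqrt h]

/-- In polar coordinates the integrand becomes a multiple of `r^{n-2}`, which is bounded for `n ≥
2`. This controls the singularity of `∇(x/|x|)`. -/
theorem integrableOn_inv_norm (hn : 2 ≤ n) :
    IntegrableOn (fun x : EuclideanSpace ℝ (Fin n) => ‖x‖⁻¹) (unitBall n) := by
  have : Nontrivial (EuclideanSpace ℝ (Fin n)) := by
    apply Module.nontrivial_of_finrank_pos (R := ℝ)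
    simp
    omega
  rw [unitBall, integrableOn_fun_norm_addHaar volume (f := fun r => r⁻¹)]
  have : IntegrableOn (fun y : ℝ => y ^ (n - 2)) (Set.Ioo 0 1) :=
    ((continuous_pow (n - 2)).continuousOn.integrableOn_compact
      (isCompact_Icc (a := (0 : ℝ)) (b := 1))).mono_set Set.Ioo_subset_Icc_self
  refine this.congr_fun (fun y hy => ?_) measurableSet_Ioo
  obtain ⟨m, rfl⟩ := Nat.exists_eq_add_of_le' hn
  have := hy.1.ne'
  simp
  field_simp
  ring

theorem isOpen_unitBall : IsOpen (unitBall n) := Metric.isOpen_ball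

theorem isBounded_unitBall : Bornology.IsBounded (unitBall n) := Metric.isBounded_ball

theorem mem_unitBall {x : EuclideanSpace ℝ (Fin n)} : x ∈ unitBall n ↔ ‖x‖ < 1 := by
  simp [unitBall]

theorem ae_unitBall_ne_zero (hn : 1 ≤ n) :
    ∀ᵐ x ∂(volume.restrict (unitBall n)), x ∈ unitBall n ∧ x ≠ 0 := by
  have : Nontrivial (EuclideanSpace ℝ (Fin n)) := by
    apply Module.nontrivial_of_finrank_pos (R := ℝ)
    simp
    omega
  filter_upwards [ae_restrict_mem isOpen_unitBall.measurableSet,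
    ae_restrict_of_ae (Measure.ae_ne volume (0 : EuclideanSpace ℝ (Fin n)))] with x h1 h2
  exact ⟨h1, h2⟩

end WeightedEnergy

namespace WeightedEnergy

variable {n : ℕ}

/-! ### Approximation of `x / |x| - x` by test functions -/

/-- A smooth radial profile on `(0, 1)`, which vanishes near the end points. -/
noncomputable def profile (κ r : ℝ) : ℝ := cutoff (κ * r) * cutoff (κ * (1 - r))

theorem contDiff_profile (κ : ℝ) : ContDiff ℝ ∞ (profile κ) :=
  (contDiff_cutoff.comp (contDiff_const.mul contDiff_id)).mul
    (contDiff_cutoff.comp (contDiff_const.mul (contDiff_const.sub contDiff_id)))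

theorem profile_nonneg (κ r : ℝ) : 0 ≤ profile κ r := mul_nonneg (cutoff_nonneg _) (cutoff_nonneg _)

theorem profile_le_one (κ r : ℝ) : profile κ r ≤ 1 :=
  mul_le_one₀ ((le_abs_self _).trans (abs_cutoff_le_one _)) (cutoff_nonneg _)
    ((le_abs_self _).trans (abs_cutoff_le_one _))

theorem hasDerivAt_profile (κ r : ℝ) :
    HasDerivAt (profile κ) (κ * deriv cutoff (κ * r) * cutoff (κ * (1 - r))
      - cutoff (κ * r) * (κ * deriv cutoff (κ * (1 - r)))) r := by
  have hc (t : ℝ) : HasDerivAt cutoff (deriv cutoff t) t :=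
    (contDiff_cutoff.differentiable (by simp) t).hasDerivAt
  have h1 : HasDerivAt (fun r => cutoff (κ * r)) (deriv cutoff (κ * r) * (κ * 1)) r :=
    HasDerivAt.comp (h₂ := cutoff) (h := fun r => κ * r) r (hc _) ((hasDerivAt_id r).const_mul κ)
  have h2 : HasDerivAt (fun r => cutoff (κ * (1 - r))) (deriv cutoff (κ * (1 - r)) * (κ * -1)) r :=
    HasDerivAt.comp (h₂ := cutoff) (h := fun r => κ * (1 - r)) r (hc _)
      (((hasDerivAt_id r).const_sub 1).const_mul κ)
  convert! h1.mul h2 using 1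
  ring

theorem profile_of_two_le {κ r : ℝ} (h1 : 2 ≤ κ * r) (h2 : 2 ≤ κ * (1 - r)) : profile κ r = 1 := by
  rw [profile, cutoff_of_two_le h1, cutoff_of_two_le h2, mul_one]

theorem deriv_profile_of_two_lt {κ r : ℝ} (h1 : 2 < κ * r) (h2 : 2 < κ * (1 - r)) :
    deriv (profile κ) r = 0 := by
  rw [(hasDerivAt_profile κ r).deriv, deriv_cutoff_of_two_lt h1, deriv_cutoff_of_two_lt h2]
  ring

/-- The factor `1 - r` is the length of `x/|x| - x`. It absorbs the `κ` from the cutoff at the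
sphere, while the `κ` from the cutoff at the origin costs `1/r`; the bound is thus uniform in `κ`
and integrable on the ball. -/
theorem exists_abs_deriv_profile_mul_le : ∃ C, 0 ≤ C ∧ ∀ κ r : ℝ, 0 < r → r < 1 →
    |deriv (profile κ) r| * (1 - r) ≤ C * r⁻¹ := by
  obtain ⟨C, hC⟩ := exists_abs_mul_deriv_cutoff_le
  have hC0 : 0 ≤ C := (abs_nonneg _).trans (hC 0)
  refine ⟨2 * C, by positivity, fun κ r h0 h1 => ?_⟩
  have hr : 1 ≤ r⁻¹ := (one_le_inv₀ h0).2 h1.le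
  -- Each `κ` is paired with the argument of its own cutoff, so that the scale-invariant bound
  -- applies to both terms.
  have e : deriv (profile κ) r * (1 - r)
      = (κ * r * deriv cutoff (κ * r)) * (cutoff (κ * (1 - r)) * ((1 - r) * r⁻¹))
        - cutoff (κ * r) * (κ * (1 - r) * deriv cutoff (κ * (1 - r))) := by
    rw [(hasDerivAt_profile κ r).deriv]
    field_simp
  rw [← abs_of_nonneg (sub_nonneg.2 h1.le), ← abs_mul, e]
  refine (abs_sub _ _).trans ?_
  rw [abs_mul, abs_mul (cutoff (κ * r)), abs_mul (cutoff _)]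
  have a1 : |(1 - r) * r⁻¹| ≤ r⁻¹ := by
    rw [abs_of_nonneg (mul_nonneg (by linarith) (by positivity))]
    exact mul_le_of_le_one_left (by positivity) (by linarith)
  have a2 : |κ * r * deriv cutoff (κ * r)| * (|cutoff (κ * (1 - r))| * |(1 - r) * r⁻¹|)
      ≤ C * (1 * r⁻¹) := by
    gcongr
    · exact hC _
    · exact abs_cutoff_le_one _
  have a3 : |cutoff (κ * r)| * |κ * (1 - r) * deriv cutoff (κ * (1 - r))| ≤ 1 * C := by
    gcongr
    · exact abs_cutoff_le_one _
    · exact hC _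
  nlinarith

/-- Smooth approximations of `x / |x| - x` with compact support in the unit ball. -/
noncomputable def radialApprox (κ : ℝ) (x : EuclideanSpace ℝ (Fin n)) : EuclideanSpace ℝ (Fin n) :=
  profile κ ‖x‖ • (radialMap n x - x)

theorem hasFDerivAt_radialApprox (κ : ℝ) {x : EuclideanSpace ℝ (Fin n)} (hx : x ≠ 0) :
    HasFDerivAt (radialApprox κ)
      (profile κ ‖x‖ • (radialDeriv x - ContinuousLinearMap.id ℝ _)
        + (deriv (profile κ) ‖x‖ • innerSL ℝ (radialMap n x)).smulRight (radialMap n x - x)) x :=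
  (((contDiff_profile κ).differentiable (by simp) ‖x‖).hasDerivAt.comp_hasFDerivAt x
    (hasFDerivAt_norm_of_ne_zero hx)).smul ((hasFDerivAt_radialMap hx).sub (hasFDerivAt_id x))

theorem contDiff_radialApprox (κ : ℝ) : ContDiff ℝ ∞ (radialApprox (n := n) κ) := by
  rw [contDiff_iff_contDiffAt]
  intro x
  by_cases hx : x = 0
  · have h0 : Tendsto (fun y : EuclideanSpace ℝ (Fin n) => κ * ‖y‖) (𝓝 x) (𝓝 0) := by
      have : Continuous fun y : EuclideanSpace ℝ (Fin n) => κ * ‖y‖ := by fun_prop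
      simpa [hx] using this.tendsto x
    -- The inner cutoff vanishes on a neighbourhood of the origin, which removes the singularity of
    -- `x/|x|`.
    have : radialApprox κ =ᶠ[𝓝 x] fun _ => 0 := by
      filter_upwards [h0.eventually_le_const one_pos] with y hy
      rw [radialApprox, profile, cutoff_of_le_one hy, zero_mul, zero_smul]
    exact contDiffAt_const.congr_of_eventuallyEq this
  · exact ((contDiff_profile κ).contDiffAt.comp x (contDiffAt_norm ℝ hx)).smul
      ((contDiffAt_radialMap hx).sub contDiffAt_id)

theorem isTestFunction_radialApprox {κ : ℝ} (hκ : 0 < κ) :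
    IsTestFunction (unitBall n) (radialApprox κ) := by
  have hsub : tsupport (radialApprox (n := n) κ) ⊆ Metric.closedBall 0 (1 - κ⁻¹) := by
    refine closure_minimal (fun x hx => ?_) Metric.isClosed_closedBall
    rw [mem_closedBall_zero_iff]
    by_contra! hlt
    apply hx
    have : κ * (1 - ‖x‖) ≤ 1 := by
      have := mul_le_mul_of_nonneg_left hlt.le hκ.le
      rw [mul_sub, mul_inv_cancel₀ hκ.ne'] at this
      linarith
    rw [radialApprox, profile, cutoff_of_le_one this, mul_zero, zero_smul]
  refine ⟨contDiff_radialApprox κ, ?_, hsub.trans ?_⟩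
  · exact (isCompact_closedBall _ _).of_isClosed_subset (isClosed_tsupport _) hsub
  · exact Metric.closedBall_subset_ball (by simpa using hκ)

theorem norm_radialMap_sub {x : EuclideanSpace ℝ (Fin n)} (hx : x ∈ unitBall n) (hx0 : x ≠ 0) :
    ‖radialMap n x - x‖ = 1 - ‖x‖ := by
  have : radialMap n x - x = (1 - ‖x‖) • radialMap n x := by
    rw [sub_smul, one_smul, norm_smul_radialMap]
  rw [this, norm_smul, norm_radialMap hx0, mul_one, Real.norm_of_nonneg]
  linarith [mem_unitBall.1 hx]

theorem norm_radialDeriv_sub_id_le {x : EuclideanSpace ℝ (Fin n)} (hx : x ∈ unitBall n)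
    (hx0 : x ≠ 0) :
    ‖radialDeriv x - ContinuousLinearMap.id ℝ (EuclideanSpace ℝ (Fin n))‖ ≤ 3 * ‖x‖⁻¹ := by
  have h1 : 1 ≤ ‖x‖⁻¹ := (one_le_inv₀ (norm_pos_iff.2 hx0)).2 (mem_unitBall.1 hx).le
  have h2 : ‖ContinuousLinearMap.id ℝ (EuclideanSpace ℝ (Fin n))‖ ≤ 1 :=
    ContinuousLinearMap.norm_id_le
  linarith [norm_sub_le (radialDeriv x) (ContinuousLinearMap.id ℝ (EuclideanSpace ℝ (Fin n))),
    norm_radialDeriv_le x]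

/-- Dominated convergence, with bound `1` for the maps and `(3 + C)/|x|` for the derivatives; at
each `x ≠ 0` of the ball both sequences are eventually stationary. The shift `k + 1` keeps the scale
positive. -/
theorem isW11Limit_radialMap_sub (hn : 2 ≤ n) :
    IsW11Limit (unitBall n) (fun x => radialMap n x - x)
      (fun x => radialDeriv x - ContinuousLinearMap.id ℝ _)
      (fun k : ℕ => radialApprox ((k : ℝ) + 1)) := by
  have hae := ae_unitBall_ne_zero (n := n) (by omega)
  have hinv := integrableOn_inv_norm hn
  have h1i : IntegrableOn (fun _ => (1 : ℝ)) (unitBall n) :=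
    integrableOn_of_isBounded isBounded_unitBall continuous_const
  have hwm : AEStronglyMeasurable (fun x => radialMap n x - x) (volume.restrict (unitBall n)) :=
    (stronglyMeasurable_radialMap.sub continuous_id.stronglyMeasurable).aestronglyMeasurable
  have hGm : AEStronglyMeasurable
      (fun x => radialDeriv x - ContinuousLinearMap.id ℝ (EuclideanSpace ℝ (Fin n)))
      (volume.restrict (unitBall n)) :=
    (stronglyMeasurable_radialDeriv.sub stronglyMeasurable_const).aestronglyMeasurable
  have hw1 : ∀ᵐ x ∂(volume.restrict (unitBall n)), ‖radialMap n x - x‖ ≤ 1 := by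
    filter_upwards [hae] with x hx
    rw [norm_radialMap_sub hx.1 hx.2]
    linarith [norm_nonneg x]
  have hG1 : ∀ᵐ x ∂(volume.restrict (unitBall n)),
      ‖radialDeriv x - ContinuousLinearMap.id ℝ (EuclideanSpace ℝ (Fin n))‖ ≤ 3 * ‖x‖⁻¹ := by
    filter_upwards [hae] with x hx using norm_radialDeriv_sub_id_le hx.1 hx.2
  -- Strict inequalities, because the derivatives of the cutoffs must vanish too.
  have hev (x : EuclideanSpace ℝ (Fin n)) (hx : x ∈ unitBall n ∧ x ≠ 0) :
      ∀ᶠ k : ℕ in atTop, 2 < ((k : ℝ) + 1) * ‖x‖ ∧ 2 < ((k : ℝ) + 1) * (1 - ‖x‖) := by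
    have ht : Tendsto (fun k : ℕ => (k : ℝ) + 1) atTop atTop :=
      tendsto_atTop_add_const_right _ _ tendsto_natCast_atTop_atTop
    exact ((ht.atTop_mul_const (norm_pos_iff.2 hx.2)).eventually_gt_atTop 2).and
      ((ht.atTop_mul_const (sub_pos.2 (mem_unitBall.1 hx.1))).eventually_gt_atTop 2)
  have htest (k : ℕ) : IsTestFunction (unitBall n) (radialApprox (n := n) ((k : ℝ) + 1)) :=
    isTestFunction_radialApprox (by positivity)
  refine ⟨Integrable.mono' h1i hwm hw1, Integrable.mono' (hinv.const_mul 3) hGm hG1, htest, ?_, ?_⟩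
  · refine tendsto_eLpNorm_one_zero_of_dominated
      (fun k => hwm.sub (htest k).integrable_map.1) h1i (fun k => ?_) ?_
    · filter_upwards [hw1] with x hx
      have : radialMap n x - x - radialApprox ((k : ℝ) + 1) x
          = (1 - profile ((k : ℝ) + 1) ‖x‖) • (radialMap n x - x) := by
        rw [radialApprox, sub_smul, one_smul]
      rw [this, norm_smul]
      refine mul_le_one₀ ?_ (norm_nonneg _) hx
      rw [Real.norm_eq_abs, abs_le]
      constructor <;> linarith [profile_nonneg ((k : ℝ) + 1) ‖x‖, profile_le_one ((k : ℝ) + 1) ‖x‖]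
    · filter_upwards [hae] with x hx
      refine tendsto_const_nhds.congr' ?_
      filter_upwards [hev x hx] with k hk
      rw [radialApprox, profile_of_two_le hk.1.le hk.2.le, one_smul, sub_self]
  · obtain ⟨C, hC0, hC⟩ := exists_abs_deriv_profile_mul_le
    refine tendsto_eLpNorm_one_zero_of_dominated
      (fun k => hGm.sub (htest k).integrable_fderiv.1) (hinv.const_mul (3 + C)) (fun k => ?_) ?_
    · filter_upwards [hae, hG1] with x hx hGx
      rw [(hasFDerivAt_radialApprox _ hx.2).fderiv, ← sub_sub]
      have e : ∀ (A : EuclideanSpace ℝ (Fin n) →L[ℝ] EuclideanSpace ℝ (Fin n)) (c : ℝ),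
          A - c • A = (1 - c) • A := fun A c => by
        ext; simp [sub_mul]
      rw [e, add_mul]
      refine (norm_sub_le _ _).trans (add_le_add ?_ ?_)
      · rw [norm_smul]
        refine (mul_le_of_le_one_left (norm_nonneg _) ?_).trans hGx
        rw [Real.norm_eq_abs, abs_le]
        constructor <;>
          linarith [profile_nonneg ((k : ℝ) + 1) ‖x‖, profile_le_one ((k : ℝ) + 1) ‖x‖]
      · rw [ContinuousLinearMap.norm_smulRight_apply, norm_smul, innerSL_apply_norm,
          norm_radialMap hx.2, mul_one, norm_radialMap_sub hx.1 hx.2]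
        exact hC _ _ (norm_pos_iff.2 hx.2) (mem_unitBall.1 hx.1)
    · filter_upwards [hae] with x hx
      refine tendsto_const_nhds.congr' ?_
      filter_upwards [hev x hx] with k hk
      rw [(hasFDerivAt_radialApprox _ hx.2).fderiv, profile_of_two_le hk.1.le hk.2.le,
        deriv_profile_of_two_lt hk.1 hk.2]
      simp

theorem HasWeakFDeriv.add_id
    {w : EuclideanSpace ℝ (Fin n) → EuclideanSpace ℝ (Fin n)}
    {G : EuclideanSpace ℝ (Fin n) → EuclideanSpace ℝ (Fin n) →L[ℝ] EuclideanSpace ℝ (Fin n)}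
    (h : HasWeakFDeriv (unitBall n) w G) :
    HasWeakFDeriv (unitBall n) (fun x => w x + x)
      (fun x => G x + ContinuousLinearMap.id ℝ _) := by
  have := h.add_contDiff (g := fun x => x) contDiff_id
    (integrableOn_of_isBounded isBounded_unitBall continuous_id)
    (integrableOn_of_isBounded isBounded_unitBall
      (contDiff_id.continuous_fderiv one_ne_zero))
  simpa only [fderiv_fun_id] using this

theorem hasWeakFDeriv_radialMap (hn : 2 ≤ n) :
    HasWeakFDeriv (unitBall n) (radialMap n) radialDeriv := by
  simpa using (isW11Limit_radialMap_sub hn).hasWeakFDeriv.add_id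

theorem isAdmissible_radialMap (hn : 2 ≤ n) : IsAdmissible (radialMap n) where
  memW11 := ⟨_, hasWeakFDeriv_radialMap hn⟩
  norm_eq_one := by
    filter_upwards [ae_unitBall_ne_zero (n := n) (by omega)] with x hx using norm_radialMap hx.2
  boundary := (isW11Limit_radialMap_sub hn).memW11Zero

end WeightedEnergy

namespace WeightedEnergy

variable {n : ℕ} {u : EuclideanSpace ℝ (Fin n) → EuclideanSpace ℝ (Fin n)}

/-! ### Admissible maps -/

/-- `weakFDeriv` is a choice unrelated to the derivative in the boundary condition. Uniqueness
identifies the two, which makes the approximation by test functions available for it. -/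
theorem IsAdmissible.exists_isW11Limit (h : IsAdmissible u) :
    ∃ G φ, IsW11Limit (unitBall n) (fun x => u x - x) G φ ∧
      weakFDeriv (unitBall n) u =ᵐ[volume.restrict (unitBall n)]
        fun x => G x + ContinuousLinearMap.id ℝ _ := by
  obtain ⟨G, φ, hG⟩ := h.boundary.exists_isW11Limit
  refine ⟨G, φ, hG, h.memW11.hasWeakFDeriv.ae_eq isOpen_unitBall ?_⟩
  simpa using hG.hasWeakFDeriv.add_id

theorem IsAdmissible.integrableOn_weakFDeriv (h : IsAdmissible u) :
    IntegrableOn (weakFDeriv (unitBall n) u) (unitBall n) :=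
  h.memW11.hasWeakFDeriv.integrable_deriv

theorem IsAdmissible.inner_weakFDeriv_eq_zero (h : IsAdmissible u)
    (v : EuclideanSpace ℝ (Fin n)) :
    ∀ᵐ x ∂(volume.restrict (unitBall n)), inner ℝ (u x) (weakFDeriv (unitBall n) u x v) = 0 := by
  obtain ⟨G, φ, hG, hae⟩ := h.exists_isW11Limit
  have := hG.inner_deriv_eq_zero isOpen_unitBall isBounded_unitBall (by simpa using h.norm_eq_one) v
  filter_upwards [this, hae] with x hx hx'
  rw [hx']
  simpa using hx

theorem IsAdmissible.euclTrace_le (h : IsAdmissible u) :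
    ∀ᵐ x ∂(volume.restrict (unitBall n)), euclTrace (weakFDeriv (unitBall n) u x)
      ≤ √((n : ℝ) - 1) * hsNorm (weakFDeriv (unitBall n) u x) := by
  have := ae_all_iff.2 fun i : Fin n => h.inner_weakFDeriv_eq_zero (EuclideanSpace.single i 1)
  filter_upwards [this, h.norm_eq_one] with x hx hx' using euclTrace_le_sqrt_mul_hsNorm hx' hx

/-- The difference of the divergences of `u` and of `x / |x|`. -/
noncomputable def divDiff (u : EuclideanSpace ℝ (Fin n) → EuclideanSpace ℝ (Fin n))
    (x : EuclideanSpace ℝ (Fin n)) : ℝ :=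
  euclTrace (weakFDeriv (unitBall n) u x) - euclTrace (radialDeriv x)

theorem IsAdmissible.integrableOn_divDiff (hn : 2 ≤ n) (h : IsAdmissible u) :
    IntegrableOn (divDiff u) (unitBall n) :=
  Integrable.sub (integrableOn_euclTrace h.integrableOn_weakFDeriv)
    (integrableOn_euclTrace (hasWeakFDeriv_radialMap hn).integrable_deriv)

/-- `u - x/|x|` is the difference of `u - x` and `x/|x| - x`, both in `W^{1,1}_0`, so there is no
boundary term even if `H` does not vanish on the sphere. -/
theorem IsAdmissible.integral_mul_divDiff (hn : 2 ≤ n) (h : IsAdmissible u)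
    {H : EuclideanSpace ℝ (Fin n) → ℝ} (hH : ContDiff ℝ 1 H) :
    ∫ x in unitBall n, H x * divDiff u x
      = ∫ x in unitBall n, fderiv ℝ H x (radialMap n x - u x) := by
  obtain ⟨G, φ, hG, hae⟩ := h.exists_isW11Limit
  have hR := isW11Limit_radialMap_sub hn
  have e1 := hG.integral_mul_euclTrace isOpen_unitBall.measurableSet isBounded_unitBall hH
  have e2 := hR.integral_mul_euclTrace isOpen_unitBall.measurableSet isBounded_unitBall hH
  have hK : IsCompact (Metric.closedBall (0 : EuclideanSpace ℝ (Fin n)) 1) :=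
    isCompact_closedBall _ _
  obtain ⟨C, hC⟩ := hK.exists_bound_of_continuousOn hH.continuous.continuousOn
  obtain ⟨D, hD⟩ := hK.exists_bound_of_continuousOn
    (hH.continuous_fderiv one_ne_zero).continuousOn
  have hmem : ∀ᵐ x ∂(volume.restrict (unitBall n)), x ∈ Metric.closedBall 0 1 := by
    filter_upwards [ae_restrict_mem isOpen_unitBall.measurableSet] with x hx
    exact Metric.ball_subset_closedBall hx
  have i1 (A : EuclideanSpace ℝ (Fin n) → EuclideanSpace ℝ (Fin n) →L[ℝ] EuclideanSpace ℝ (Fin n))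
      (hA : IntegrableOn A (unitBall n)) :
      Integrable (fun x => H x * euclTrace (A x)) (volume.restrict (unitBall n)) :=
    Integrable.bdd_mul (integrableOn_euclTrace hA) hH.continuous.aestronglyMeasurable
      (hmem.mono hC)
  have i2 (w : EuclideanSpace ℝ (Fin n) → EuclideanSpace ℝ (Fin n))
      (hw : IntegrableOn w (unitBall n)) :
      Integrable (fun x => fderiv ℝ H x (w x)) (volume.restrict (unitBall n)) := by
    refine Integrable.mono' (hw.norm.const_mul D) ?_ (hmem.mono fun x hx => ?_)
    · exact (ContinuousLinearMap.apply ℝ ℝ).flip.aestronglyMeasurable_comp₂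
        (hH.continuous_fderiv one_ne_zero).aestronglyMeasurable hw.1
    · exact (ContinuousLinearMap.le_opNorm _ _).trans
        (mul_le_mul_of_nonneg_right (hD x hx) (norm_nonneg _))
  have e3 : ∫ x in unitBall n, H x * divDiff u x
      = (∫ x in unitBall n, H x * euclTrace (G x))
        - ∫ x in unitBall n, H x * euclTrace (radialDeriv x - ContinuousLinearMap.id ℝ _) := by
    rw [← integral_sub (i1 _ hG.integrable_deriv) (i1 _ hR.integrable_deriv)]
    refine integral_congr_ae (hae.mono fun x hx => ?_)
    simp only
    rw [← mul_sub, ← euclTrace_sub, divDiff, hx, ← euclTrace_sub]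
    congr 2
    ext1 v
    simp only [sub_apply, add_apply]
    abel
  rw [e3, e1, e2, sub_neg_eq_add, neg_add_eq_sub,
    ← integral_sub (i2 _ hR.integrable_map) (i2 _ hG.integrable_map)]
  refine integral_congr_ae (Eventually.of_forall fun x => ?_)
  simp only [← map_sub]
  congr 1
  abel

/-! ### The flux through spheres -/

theorem inner_radialMap_sub_nonneg {x y : EuclideanSpace ℝ (Fin n)} (hx : x ≠ 0) (hy : ‖y‖ = 1) :
    0 ≤ inner ℝ (radialMap n x) (radialMap n x - y) := by
  rw [inner_sub_right, real_inner_self_eq_norm_sq, norm_radialMap hx]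
  have := real_inner_le_norm (radialMap n x) y
  rw [norm_radialMap hx, hy] at this
  linarith

/-- The integral of `div (u - x / |x|)` over the part of the ball outside the sphere of
radius `s`. -/
noncomputable def outerDiv (u : EuclideanSpace ℝ (Fin n) → EuclideanSpace ℝ (Fin n)) (s : ℝ) : ℝ :=
  ∫ x in unitBall n, (Set.Ioi s).indicator 1 ‖x‖ * divDiff u x

/-- A smoothed flux inequality: the gradient of `g(|x|)` is `g'(|x|) x/|x|`, and `x/|x|` has the
largest product with itself among unit vectors. Vanishing of `g` up to `s > 0` makes `g(|x|)` smooth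
enough at the origin. -/
theorem IsAdmissible.integral_radial_mul_divDiff_nonneg (hn : 2 ≤ n) (h : IsAdmissible u)
    {g : ℝ → ℝ} (hg : ContDiff ℝ 1 g) (hmono : Monotone g) {s : ℝ} (hs : 0 < s)
    (hg0 : ∀ r ≤ s, g r = 0) :
    0 ≤ ∫ x in unitBall n, g ‖x‖ * divDiff u x := by
  have hH : ContDiff ℝ 1 fun x : EuclideanSpace ℝ (Fin n) => g ‖x‖ := by
    rw [contDiff_iff_contDiffAt]
    intro x
    by_cases hx : x = 0
    · have : (fun y : EuclideanSpace ℝ (Fin n) => g ‖y‖) =ᶠ[𝓝 x] fun _ => 0 := by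
        filter_upwards [(continuous_norm.tendsto x).eventually_le_const
          (by simpa [hx] using hs)] with y hy using hg0 _ hy
      exact contDiffAt_const.congr_of_eventuallyEq this
    · exact hg.contDiffAt.comp x (contDiffAt_norm ℝ hx)
  rw [h.integral_mul_divDiff hn hH]
  refine integral_nonneg_of_ae ?_
  filter_upwards [ae_unitBall_ne_zero (n := n) (by omega), h.norm_eq_one] with x hx hux
  have hd := (hg.differentiable one_ne_zero ‖x‖).hasDerivAt.comp_hasFDerivAt x
    (hasFDerivAt_norm_of_ne_zero hx.2)
  have hd' : fderiv ℝ (fun x : EuclideanSpace ℝ (Fin n) => g ‖x‖) x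
      = deriv g ‖x‖ • innerSL ℝ (radialMap n x) := hd.fderiv
  rw [hd', Pi.zero_apply, smul_apply, innerSL_apply_apply, smul_eq_mul]
  exact mul_nonneg hmono.deriv_nonneg (inner_radialMap_sub_nonneg hx.2 hux)

/-- Formally this is the flux of `x/|x| - u` through the sphere of radius `s`. Approximating the
indicator of `(s, ∞)` by smooth monotone steps avoids traces on spheres. -/
theorem IsAdmissible.outerDiv_nonneg (hn : 2 ≤ n) (h : IsAdmissible u) {s : ℝ} (hs : 0 < s) :
    0 ≤ outerDiv u s := by
  have hd := h.integrableOn_divDiff hn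
  have hlim : Tendsto (fun k : ℕ => ∫ x in unitBall n,
      Real.smoothTransition (k * (‖x‖ - s)) * divDiff u x) atTop (𝓝 (outerDiv u s)) := by
    refine tendsto_integral_of_dominated_convergence (fun x => ‖divDiff u x‖) (fun k => ?_)
      hd.norm (fun k => Eventually.of_forall fun x => ?_) (Eventually.of_forall fun x => ?_)
    · refine AEStronglyMeasurable.mul (Continuous.aestronglyMeasurable ?_) hd.1
      exact Real.smoothTransition.continuous.comp (by fun_prop)
    · rw [norm_mul]
      refine mul_le_of_le_one_left (norm_nonneg _) ?_
      rw [Real.norm_of_nonneg (Real.smoothTransition.nonneg _)]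
      exact Real.smoothTransition.le_one _
    · refine Tendsto.mul_const _ (tendsto_const_nhds.congr' ?_)
      by_cases hx : s < ‖x‖
      · filter_upwards [(tendsto_natCast_atTop_atTop.atTop_mul_const
          (sub_pos.2 hx)).eventually_ge_atTop 1] with k hk
        rw [Real.smoothTransition.one_of_one_le hk, Set.indicator_of_mem (Set.mem_Ioi.2 hx)]
        rfl
      · refine Eventually.of_forall fun k => ?_
        simp only
        rw [Real.smoothTransition.zero_of_nonpos, Set.indicator_of_notMem (by simpa using hx)]
        exact mul_nonpos_of_nonneg_of_nonpos (Nat.cast_nonneg _) (by linarith)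
  refine ge_of_tendsto' hlim fun k => ?_
  refine h.integral_radial_mul_divDiff_nonneg hn (g := fun r => Real.smoothTransition (k * (r - s)))
    ?_ (fun a b hab => Real.smoothTransition.monotone ?_) hs fun r hr => ?_
  · exact Real.smoothTransition.contDiff.comp (contDiff_const.mul (contDiff_id.sub contDiff_const))
  · gcongr
  · exact Real.smoothTransition.zero_of_nonpos
      (mul_nonpos_of_nonneg_of_nonpos (Nat.cast_nonneg _) (by linarith))

theorem integrable_indicator_prod {d : EuclideanSpace ℝ (Fin n) → ℝ}
    (hd : IntegrableOn d (unitBall n)) {g : ℝ → ℝ} (hg : IntegrableOn g (Set.Ioo 0 1)) :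
    Integrable (fun p : EuclideanSpace ℝ (Fin n) × ℝ =>
      (Set.Ioi p.2).indicator (1 : ℝ → ℝ) ‖p.1‖ * (d p.1 * g p.2))
      ((volume.restrict (unitBall n)).prod (volume.restrict (Set.Ioo 0 1))) := by
  have hm : MeasurableSet {p : EuclideanSpace ℝ (Fin n) × ℝ | p.2 < ‖p.1‖} :=
    measurableSet_lt measurable_snd measurable_fst.norm
  refine ((Integrable.mul_prod hd hg).indicator hm).congr (Eventually.of_forall fun p => ?_)
  by_cases hp : p.2 < ‖p.1‖ <;> simp [Set.indicator, hp]

/-- The layer cake formula for the weighted integral of a divergence. -/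
theorem integral_radial_mul {d : EuclideanSpace ℝ (Fin n) → ℝ}
    (hd : IntegrableOn d (unitBall n)) {f : ℝ → ℝ} (hc : ContinuousOn f (Set.Icc 0 1))
    (hf : ∀ r ∈ Set.Ioo (0 : ℝ) 1, DifferentiableAt ℝ f r)
    (hf' : IntegrableOn (deriv f) (Set.Ioo 0 1)) :
    ∫ x in unitBall n, f ‖x‖ * d x = f 0 * (∫ x in unitBall n, d x)
      + ∫ s in Set.Ioo 0 1,
        deriv f s * ∫ x in unitBall n, (Set.Ioi s).indicator 1 ‖x‖ * d x := by
  have hi := integrable_indicator_prod hd hf'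
  have hswap := integral_integral_swap (f := fun (x : EuclideanSpace ℝ (Fin n)) (s : ℝ) =>
    (Set.Ioi s).indicator (1 : ℝ → ℝ) ‖x‖ * (d x * deriv f s)) hi
  -- The fundamental theorem of calculus on `[0, |x|]`; differentiability inside and integrability
  -- of `f'` suffice, without continuity of `f'`.
  have inner_eq (x : EuclideanSpace ℝ (Fin n)) (hx : x ∈ unitBall n) :
      ∫ s in Set.Ioo 0 1, (Set.Ioi s).indicator (1 : ℝ → ℝ) ‖x‖ * (d x * deriv f s)
        = (f ‖x‖ - f 0) * d x := by
    have hx1 := mem_unitBall.1 hx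
    have e (s : ℝ) : (Set.Ioi s).indicator (1 : ℝ → ℝ) ‖x‖ * (d x * deriv f s)
        = (Set.Iio ‖x‖).indicator (fun s => deriv f s * d x) s := by
      by_cases hs : s < ‖x‖ <;> simp [Set.indicator, hs, mul_comm]
    simp only [e]
    rw [setIntegral_indicator measurableSet_Iio, Set.Ioo_inter_Iio, min_eq_right hx1.le,
      integral_mul_const, ← integral_Ioc_eq_integral_Ioo,
      ← intervalIntegral.integral_of_le (norm_nonneg x),
      intervalIntegral.integral_eq_sub_of_hasDerivAt_of_le (norm_nonneg x)
        (hc.mono (Set.Icc_subset_Icc_right hx1.le))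
        (fun r hr => (hf r ⟨hr.1, hr.2.trans hx1⟩).hasDerivAt)]
    rw [intervalIntegrable_iff_integrableOn_Ioo_of_le (norm_nonneg x)]
    exact hf'.mono_set (Set.Ioo_subset_Ioo_right hx1.le)
  have e1 : ∫ x in unitBall n, (f ‖x‖ - f 0) * d x = ∫ s in Set.Ioo 0 1,
        deriv f s * ∫ x in unitBall n, (Set.Ioi s).indicator 1 ‖x‖ * d x := by
    rw [← setIntegral_congr_fun isOpen_unitBall.measurableSet inner_eq, hswap]
    refine integral_congr_ae (Eventually.of_forall fun s => ?_)
    simp only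
    rw [← integral_const_mul]
    refine integral_congr_ae (Eventually.of_forall fun x => ?_)
    simp only
    ring
  have i1 : Integrable (fun x => (f ‖x‖ - f 0) * d x) (volume.restrict (unitBall n)) :=
    hi.integral_prod_left.congr (by
      filter_upwards [ae_restrict_mem isOpen_unitBall.measurableSet] with x hx using inner_eq x hx)
  rw [← e1, ← integral_const_mul, ← integral_add (hd.const_mul _) i1]
  refine integral_congr_ae (Eventually.of_forall fun x => ?_)
  simp only
  ring

theorem IsAdmissible.integral_divDiff_eq_zero (hn : 2 ≤ n) (h : IsAdmissible u) :
    ∫ x in unitBall n, divDiff u x = 0 := by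
  have := h.integral_mul_divDiff hn (H := fun _ => 1) contDiff_const
  simpa using this

/-- The `f 0` term of the layer cake formula drops because the total divergence vanishes.
Integrability is recorded for the equality case, where a nonnegative integrand has integral zero. -/
theorem IsAdmissible.integral_radial_mul_divDiff (hn : 2 ≤ n) (h : IsAdmissible u) {f : ℝ → ℝ}
    (hc : ContinuousOn f (Set.Icc 0 1)) (hf : ∀ r ∈ Set.Ioo (0 : ℝ) 1, DifferentiableAt ℝ f r)
    (hf' : IntegrableOn (deriv f) (Set.Ioo 0 1)) :
    IntegrableOn (fun s => deriv f s * outerDiv u s) (Set.Ioo 0 1) ∧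
    ∫ x in unitBall n, f ‖x‖ * divDiff u x = ∫ s in Set.Ioo 0 1, deriv f s * outerDiv u s := by
  constructor
  · refine (integrable_indicator_prod (h.integrableOn_divDiff hn) hf').integral_prod_right.congr
      (Eventually.of_forall fun s => ?_)
    simp only [outerDiv]
    rw [← integral_const_mul]
    refine integral_congr_ae (Eventually.of_forall fun x => ?_)
    simp only
    ring
  · rw [integral_radial_mul (h.integrableOn_divDiff hn) hc hf hf', h.integral_divDiff_eq_zero hn,
      mul_zero, zero_add]
    rfl

/-- If no flux is lost, then the map is `x / |x|`. -/
theorem IsAdmissible.ae_eq_radialMap (hn : 2 ≤ n) (h : IsAdmissible u)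
    (h0 : ∀ᵐ s ∂(volume.restrict (Set.Ioo (0 : ℝ) 1)), outerDiv u s = 0) :
    u =ᵐ[volume.restrict (unitBall n)] radialMap n := by
  have hd (r : ℝ) : HasDerivAt (fun r : ℝ => r ^ 2 / 2) r r := by
    convert! (hasDerivAt_pow 2 r).div_const 2 using 1
    simp
  have hderiv : deriv (fun r : ℝ => r ^ 2 / 2) = fun r => r := funext fun r => (hd r).deriv
  -- The auxiliary weight `r²/2` is independent of the energy and is chosen because `|x|²/2` is
  -- smooth with gradient `x`. Its weighted divergence is computed twice: by layers it is `0`, by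
  -- parts it is `∫ ⟨x, x/|x| - u⟩`.
  have e1 := (h.integral_radial_mul_divDiff hn (f := fun r => r ^ 2 / 2)
    (by fun_prop) (fun r _ => (hd r).differentiableAt) (by
      rw [hderiv]
      exact (continuous_id.continuousOn.integrableOn_compact
        (isCompact_Icc (a := (0 : ℝ)) (b := 1))).mono_set Set.Ioo_subset_Icc_self)).2
  have e2 : ∫ s in Set.Ioo (0 : ℝ) 1, deriv (fun r : ℝ => r ^ 2 / 2) s * outerDiv u s = 0 := by
    refine integral_eq_zero_of_ae (h0.mono fun s hs => ?_)
    simp [hs]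
  have hH (x : EuclideanSpace ℝ (Fin n)) :
      HasFDerivAt (fun x : EuclideanSpace ℝ (Fin n) => ‖x‖ ^ 2 / 2) (innerSL ℝ x) x := by
    have := (hasStrictFDerivAt_norm_sq x).hasFDerivAt.mul_const (2⁻¹ : ℝ)
    convert! this using 1
    ext v
    simp
  rw [e2, h.integral_mul_divDiff hn (H := fun x => ‖x‖ ^ 2 / 2)
    ((contDiff_norm_sq ℝ).div_const 2)] at e1
  simp only [(hH _).fderiv, innerSL_apply_apply] at e1
  have hnn : ∀ᵐ x ∂(volume.restrict (unitBall n)), 0 ≤ inner ℝ x (radialMap n x - u x) := by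
    filter_upwards [ae_unitBall_ne_zero (n := n) (by omega), h.norm_eq_one] with x hx hux
    have := inner_radialMap_sub_nonneg hx.2 hux
    rw [← norm_smul_radialMap x, inner_smul_left, norm_smul_radialMap x]
    exact mul_nonneg (norm_nonneg x) this
  have hint : Integrable (fun x => inner ℝ x (radialMap n x - u x))
      (volume.restrict (unitBall n)) := by
    have hsub := (hasWeakFDeriv_radialMap hn).integrable_map.sub
      h.memW11.hasWeakFDeriv.integrable_map
    refine Integrable.mono' hsub.norm
      (continuous_id.aestronglyMeasurable.inner hsub.1) ?_
    filter_upwards [ae_restrict_mem isOpen_unitBall.measurableSet] with x hx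
    exact (norm_inner_le_norm _ _).trans
      (mul_le_of_le_one_left (norm_nonneg _) (mem_unitBall.1 hx).le)
  rw [integral_eq_zero_iff_of_nonneg_ae hnn hint] at e1
  filter_upwards [e1, ae_unitBall_ne_zero (n := n) (by omega), h.norm_eq_one] with x hx hx0 hux
  rw [← norm_smul_radialMap x, inner_smul_left, norm_smul_radialMap x] at hx
  have h1 : inner ℝ (radialMap n x) (radialMap n x - u x) = 0 :=
    (mul_eq_zero.1 hx).resolve_left (by simpa using hx0.2)
  rw [inner_sub_right, real_inner_self_eq_norm_sq, norm_radialMap hx0.2] at h1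
  -- Equality in Cauchy–Schwarz for two unit vectors.
  refine ((inner_eq_one_iff_of_norm_eq_one (𝕜 := ℝ) (norm_radialMap hx0.2) hux).1 ?_).symm
  linarith

end WeightedEnergy

namespace WeightedEnergy

variable {n : ℕ} {u : EuclideanSpace ℝ (Fin n) → EuclideanSpace ℝ (Fin n)} {f : ℝ → ℝ}

/-! ### The energy -/

theorem exists_bound_weight (hc : ContinuousOn f (Set.Icc 0 1)) :
    ∃ C, ∀ᵐ x ∂(volume.restrict (unitBall n)), ‖f ‖x‖‖ ≤ C := by
  obtain ⟨C, hC⟩ := isCompact_Icc.exists_bound_of_continuousOn hc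
  refine ⟨C, ?_⟩
  filter_upwards [ae_restrict_mem isOpen_unitBall.measurableSet] with x hx
  exact hC _ ⟨norm_nonneg x, (mem_unitBall.1 hx).le⟩

theorem aestronglyMeasurable_weight (hc : ContinuousOn f (Set.Icc 0 1)) :
    AEStronglyMeasurable (fun x : EuclideanSpace ℝ (Fin n) => f ‖x‖)
      (volume.restrict (unitBall n)) := by
  refine ContinuousOn.aestronglyMeasurable ?_ isOpen_unitBall.measurableSet
  exact hc.comp continuous_norm.continuousOn fun x hx => ⟨norm_nonneg x, (mem_unitBall.1 hx).le⟩

theorem integrable_weight_mul (hc : ContinuousOn f (Set.Icc 0 1))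
    {d : EuclideanSpace ℝ (Fin n) → ℝ} (hd : IntegrableOn d (unitBall n)) :
    Integrable (fun x => f ‖x‖ * d x) (volume.restrict (unitBall n)) := by
  obtain ⟨C, hC⟩ := exists_bound_weight (n := n) hc
  exact Integrable.bdd_mul hd (aestronglyMeasurable_weight hc) hC

theorem ae_weight_nonneg (hf : ∀ r ∈ Set.Icc (0 : ℝ) 1, 0 ≤ f r) :
    ∀ᵐ x ∂(volume.restrict (unitBall n)), 0 ≤ f ‖x‖ := by
  filter_upwards [ae_restrict_mem isOpen_unitBall.measurableSet] with x hx
  exact hf _ ⟨norm_nonneg x, (mem_unitBall.1 hx).le⟩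

theorem IsAdmissible.energy_eq (h : IsAdmissible u) (hc : ContinuousOn f (Set.Icc 0 1))
    (hf : ∀ r ∈ Set.Icc (0 : ℝ) 1, 0 ≤ f r) :
    energy f u = ENNReal.ofReal
      (∫ x in unitBall n, f ‖x‖ * hsNorm (weakFDeriv (unitBall n) u x)) := by
  rw [energy, ofReal_integral_eq_lintegral_ofReal
    (integrable_weight_mul hc (integrableOn_hsNorm h.integrableOn_weakFDeriv))]
  filter_upwards [ae_weight_nonneg (n := n) hf] with x hx using mul_nonneg hx (hsNorm_nonneg _)

theorem weakFDeriv_radialMap_ae_eq (hn : 2 ≤ n) :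
    weakFDeriv (unitBall n) (radialMap n) =ᵐ[volume.restrict (unitBall n)] radialDeriv :=
  (isAdmissible_radialMap hn).memW11.hasWeakFDeriv.ae_eq isOpen_unitBall
    (hasWeakFDeriv_radialMap hn)

/-- The calibration inequality. -/
theorem IsAdmissible.integral_weight_mul_divDiff_le (hn : 2 ≤ n) (h : IsAdmissible u)
    (hc : ContinuousOn f (Set.Icc 0 1)) (hf : ∀ r ∈ Set.Icc (0 : ℝ) 1, 0 ≤ f r) :
    ∫ x in unitBall n, f ‖x‖ * divDiff u x
      ≤ √((n : ℝ) - 1) * ((∫ x in unitBall n, f ‖x‖ * hsNorm (weakFDeriv (unitBall n) u x))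
        - ∫ x in unitBall n, f ‖x‖ * hsNorm (weakFDeriv (unitBall n) (radialMap n) x)) := by
  have i1 := integrable_weight_mul hc (integrableOn_hsNorm h.integrableOn_weakFDeriv)
  have i2 := integrable_weight_mul hc
    (integrableOn_hsNorm (isAdmissible_radialMap hn).integrableOn_weakFDeriv)
  rw [← integral_sub i1 i2, ← integral_const_mul]
  refine integral_mono_ae (integrable_weight_mul hc (h.integrableOn_divDiff hn))
    ((i1.sub' i2).const_mul _) ?_
  filter_upwards [weakFDeriv_radialMap_ae_eq hn, ae_weight_nonneg (n := n) hf, h.euclTrace_le,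
    ae_unitBall_ne_zero (n := n) (by omega)] with x h1 h2 h3 h4
  simp only [h1, divDiff, euclTrace_radialDeriv_eq (by omega : 1 ≤ n) h4.2]
  linarith [mul_le_mul_of_nonneg_left h3 h2]

/-- The energy uses a derivative chosen separately for each map, so its invariance under null sets
rests on uniqueness of weak derivatives. -/
theorem energy_congr {v : EuclideanSpace ℝ (Fin n) → EuclideanSpace ℝ (Fin n)}
    (hu : MemW11 (unitBall n) u) (hv : MemW11 (unitBall n) v)
    (huv : u =ᵐ[volume.restrict (unitBall n)] v) : energy f u = energy f v := by
  have hw : HasWeakFDeriv (unitBall n) v (weakFDeriv (unitBall n) u) := by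
    refine ⟨hu.hasWeakFDeriv.integrable_map.congr huv, hu.hasWeakFDeriv.integrable_deriv,
      fun φ hφ e => ?_⟩
    rw [← hu.hasWeakFDeriv.integral_eq φ hφ e]
    exact integral_congr_ae (huv.mono fun x hx => by simp only [hx])
  refine lintegral_congr_ae ?_
  filter_upwards [hw.ae_eq isOpen_unitBall hv.hasWeakFDeriv] with x hx
  rw [hx]

end WeightedEnergy

/-! ### Minimality and uniqueness -/

theorem theorem0p1 (n : ℕ) (hn : 3 ≤ n) (f : ℝ → ℝ)
    (hf_nonneg : ∀ r ∈ Set.Icc (0 : ℝ) 1, 0 ≤ f r)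
    (hf_diff : DifferentiableOn ℝ f (Set.Icc 0 1))
    (hf_mono : MonotoneOn f (Set.Icc 0 1)) :
    WeightedEnergy.IsMinimizer f (WeightedEnergy.radialMap n) ∧
    ((∀ r ∈ Set.Ioo (0 : ℝ) 1, deriv f r ≠ 0) →
      ∀ u : EuclideanSpace ℝ (Fin n) → EuclideanSpace ℝ (Fin n),
        WeightedEnergy.IsAdmissible u →
        (WeightedEnergy.energy f (WeightedEnergy.radialMap n) = WeightedEnergy.energy f u ↔
          u =ᵐ[volume.restrict (WeightedEnergy.unitBall n)] WeightedEnergy.radialMap n)) := by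
  open WeightedEnergy in
  have hn2 : 2 ≤ n := by omega
  have hc := hf_diff.continuousOn
  have hd : ∀ r ∈ Set.Ioo (0 : ℝ) 1, DifferentiableAt ℝ f r := fun r hr =>
    (hf_diff r ⟨hr.1.le, hr.2.le⟩).differentiableAt (Icc_mem_nhds hr.1 hr.2)
  have hd0 : ∀ r ∈ Set.Ioo (0 : ℝ) 1, 0 ≤ deriv f r := fun r hr => by
    rw [← (hd r hr).derivWithin (uniqueDiffOn_Icc_zero_one r ⟨hr.1.le, hr.2.le⟩)]
    exact hf_mono.derivWithin_nonneg
  -- `f'` need not be continuous; it is integrable because it is nonnegative and `f` is continuous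
  -- up to the end points.
  have hdi : IntegrableOn (deriv f) (Set.Ioo 0 1) :=
    (intervalIntegral.integrableOn_deriv_of_nonneg hc (fun r hr => (hd r hr).hasDerivAt)
      hd0).mono_set Set.Ioo_subset_Ioc_self
  have hn1 : (0 : ℝ) < √((n : ℝ) - 1) := by
    have : (3 : ℝ) ≤ n := by exact_mod_cast hn
    exact Real.sqrt_pos.2 (by linarith)
  have hR := isAdmissible_radialMap hn2
  have hnn (u : EuclideanSpace ℝ (Fin n) → EuclideanSpace ℝ (Fin n)) (hu : IsAdmissible u) :
      0 ≤ᵐ[volume.restrict (Set.Ioo 0 1)] fun s => deriv f s * outerDiv u s := by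
    filter_upwards [ae_restrict_mem measurableSet_Ioo] with s hs
    exact mul_nonneg (hd0 s hs) (hu.outerDiv_nonneg hn2 hs.1)
  refine ⟨⟨hR, fun u hu => ?_⟩, fun hcrit u hu => ⟨fun hE => ?_, fun huR => ?_⟩⟩
  · rw [hR.energy_eq hc hf_nonneg, hu.energy_eq hc hf_nonneg]
    refine ENNReal.ofReal_le_ofReal ?_
    have h1 := hu.integral_weight_mul_divDiff_le hn2 hc hf_nonneg
    rw [(hu.integral_radial_mul_divDiff hn2 hc hd hdi).2] at h1
    exact sub_nonneg.1 (nonneg_of_mul_nonneg_right ((integral_nonneg_of_ae (hnn u hu)).trans h1) hn1)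
  · have hpos (v : EuclideanSpace ℝ (Fin n) → EuclideanSpace ℝ (Fin n)) :
        0 ≤ ∫ x in unitBall n, f ‖x‖ * hsNorm (weakFDeriv (unitBall n) v x) := by
      refine integral_nonneg_of_ae ?_
      filter_upwards [ae_weight_nonneg (n := n) hf_nonneg] with x hx
      exact mul_nonneg hx (hsNorm_nonneg _)
    rw [hR.energy_eq hc hf_nonneg, hu.energy_eq hc hf_nonneg,
      ENNReal.ofReal_eq_ofReal_iff (hpos _) (hpos _)] at hE
    have h1 := hu.integral_weight_mul_divDiff_le hn2 hc hf_nonneg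
    obtain ⟨hi, h2⟩ := hu.integral_radial_mul_divDiff hn2 hc hd hdi
    -- Equal energies make the upper bound of the calibration inequality zero, so the nonnegative
    -- function `f'(s) D(s)` has integral zero.
    rw [h2, hE, sub_self, mul_zero] at h1
    have h0 := (integral_eq_zero_iff_of_nonneg_ae (hnn u hu) hi).1
      (le_antisymm h1 (integral_nonneg_of_ae (hnn u hu)))
    refine hu.ae_eq_radialMap hn2 ?_
    filter_upwards [h0, ae_restrict_mem measurableSet_Ioo] with s hs hs1
    exact (mul_eq_zero.1 hs).resolve_left (hcrit s hs1)
  · exact (energy_congr hu.memW11 hR.memW11 huR).symm
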